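/- Two strings $X,Y$ of numbers of the same length $m$ are *order-equivalent*, $X\approx Y$, if $X[i]<X[j]\Leftrightarrow Y[i]<Y[j]$ for all $1\le i,j\le m$. An integer $p$ with $1\le p<n$ is an *initial op-period* of a string $S$ of length $n$ over the integers if $S$ is a prefix of a concatenation $V_1V_2\cdots V_k$ of pairwise order-equivalent strings of length $p$ (the letters of the $V_i$ may be rational numbers, so that an incomplete last block of $S$ can be completed whenever its order pattern permits). **Theorem.** All initial op-periods of a string of length $n$ over a polynomially bounded integer alphabet can be computed in $O(n\log\log n)$ worst-case time in the word-RAM model. More precisely: there is a single word-RAM program (with unit-cost addition, subtraction, multiplication, integer division, comparison and memory access) such that for every $k\in\mathbb N$ there is $K\in\mathbb N$ for which, on every input string $S$ of length $n$ whose letters are integers of absolute value at most $(n+2)^k$, the program, working with integers of absolute value at most $(n+2)^K$ (that is, with machine words of $O(\log n)$ bits), halts and outputs the increasing list of all initial op-periods of $S$, and its running time on inputs of length $n$ is $O(n\log\log n)$, where the implied constant depends only on $k$. -/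

import Mathlib

namespace OpPeriods

/-! ### Order-equivalence and op-periods -/

/-- Two strings are order-equivalent if they have the same length and the same relative order of
letters. -/
def OrderEquiv {α : Type*} [LT α] (X Y : List α) : Prop :=
  X.length = Y.length ∧
    ∀ (i j : ℕ) (_ : i < X.length) (_ : j < X.length) (_ : i < Y.length) (_ : j < Y.length),
      X[i] < X[j] ↔ Y[i] < Y[j]

/-- The string `S` has an op-period `p` with shift `s ∈ {0, ..., p - 1}`: `p < |S|` and `S` is a
factor of a string `V₁ V₂ ⋯ Vₖ` whose blocks have length `p` and are pairwise order-equivalent,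
at a position such that the suffix of `S` obtained by deleting its first `s` letters starts where
`V₂` starts, that is, it is a prefix of `V₂ ⋯ Vₖ`.

The letters of the blocks are taken in `ℚ`, so that an incomplete block at the end of `S` can be
completed whenever the relative order allows it (`1 3 2 1 2` has the op-period `3` with shift `0`,
by completing the last block to `1 2 1.5`). -/
def HasOpPeriod (S : List ℤ) (p s : ℕ) : Prop :=
  s < p ∧ p < S.length ∧
    ∃ (V₁ : List ℚ) (Vs : List (List ℚ)),
      (∀ V ∈ V₁ :: Vs, V.length = p) ∧
      (∀ V ∈ V₁ :: Vs, ∀ W ∈ V₁ :: Vs, OrderEquiv V W) ∧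
      ∃ A B : List ℚ,
        A ++ S.map (fun z : ℤ => (z : ℚ)) ++ B = (V₁ :: Vs).flatten ∧ A.length + s = p

/-- The set of all shifts of the op-period `p` of `S`. -/
def Shifts (S : List ℤ) (p : ℕ) : Set ℕ := {s | HasOpPeriod S p s}

/-- `p` is an initial op-period of `S`. -/
def IsInitialOpPeriod (S : List ℤ) (p : ℕ) : Prop := 0 ∈ Shifts S p

/-! ### The word RAM

A program is a finite piece of syntax using finitely many integer variables (registers) and
finitely many arrays (regions of the memory with random access). All values are words, that is,
integers of absolute value at most a bound `B`; every operation, memory access and test on words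
takes one unit of time. An operation that would leave the range of words, a division by zero, or
a negative address leaves the machine stuck. -/

/-- Word operations: arithmetic, and comparisons with value `1` or `0`. -/
inductive BinOp where
  | add | sub | mul | div | mod | lt | le | eq

/-- The result of a word operation, before the range check. -/
def BinOp.apply : BinOp → ℤ → ℤ → Option ℤ
  | .add, a, b => some (a + b)
  | .sub, a, b => some (a - b)
  | .mul, a, b => some (a * b)
  | .div, a, b => if b = 0 then none else some (a / b)
  | .mod, a, b => if b = 0 then none else some (a % b)
  | .lt, a, b => some (if a < b then 1 else 0)
  | .le, a, b => some (if a ≤ b then 1 else 0)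
  | .eq, a, b => some (if a = b then 1 else 0)

/-- Expressions: a constant, a variable, the cell of array `a` at a computed index, or a word
operation. -/
inductive Expr where
  | lit (c : ℤ)
  | var (x : ℕ)
  | read (a : ℕ) (e : Expr)
  | op (o : BinOp) (e f : Expr)

/-- Programs. Conditions hold if their value is nonzero. -/
inductive Prog where
  | skip
  | assign (x : ℕ) (e : Expr)
  | store (a : ℕ) (i e : Expr)
  | seq (c d : Prog)
  | cond (e : Expr) (c d : Prog)
  | loop (e : Expr) (c : Prog)

/-- A state: the values of the variables and the contents of the arrays. -/
structure State where
  var : ℕ → ℤ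
  arr : ℕ → ℕ → ℤ

/-- Assign `v` to variable `x`. -/
def State.setVar (σ : State) (x : ℕ) (v : ℤ) : State :=
  { σ with var := Function.update σ.var x v }

/-- Write `v` to cell `i` of array `a`. -/
def State.setArr (σ : State) (a i : ℕ) (v : ℤ) : State :=
  { σ with arr := Function.update σ.arr a (Function.update (σ.arr a) i v) }

/-- The range check: `v` if it is a word, and `none` otherwise. -/
def word (B : ℕ) (v : ℤ) : Option ℤ := if |v| ≤ (B : ℤ) then some v else none

/-- The value of an expression, or `none` if the machine gets stuck. -/
def Expr.value (B : ℕ) (σ : State) : Expr → Option ℤ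
  | .lit c => word B c
  | .var x => word B (σ.var x)
  | .read a e =>
      (e.value B σ).bind fun i => if 0 ≤ i then word B (σ.arr a i.toNat) else none
  | .op o e f =>
      (e.value B σ).bind fun x => (f.value B σ).bind fun y => (o.apply x y).bind (word B)

/-- The time for evaluating an expression: its number of constants, variables, memory accesses and
word operations. -/
def Expr.cost : Expr → ℕ
  | .lit _ => 1
  | .var _ => 1
  | .read _ e => e.cost + 1
  | .op _ e f => e.cost + f.cost + 1

/-- `Exec B c σ t τ`: with word bound `B`, the program `c` started in state `σ` halts after `t`
units of time in state `τ`. -/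
inductive Exec (B : ℕ) : Prog → State → ℕ → State → Prop where
  | skip (σ : State) : Exec B .skip σ 1 σ
  | assign {σ : State} {x : ℕ} {e : Expr} {v : ℤ} (he : e.value B σ = some v) :
      Exec B (.assign x e) σ (e.cost + 1) (σ.setVar x v)
  | store {σ : State} {a : ℕ} {i e : Expr} {j v : ℤ} (hi : i.value B σ = some j) (hj : 0 ≤ j)
      (he : e.value B σ = some v) :
      Exec B (.store a i e) σ (i.cost + e.cost + 1) (σ.setArr a j.toNat v)
  | seq {σ τ ρ : State} {c d : Prog} {s t : ℕ} (hc : Exec B c σ s τ) (hd : Exec B d τ t ρ) :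
      Exec B (.seq c d) σ (s + t) ρ
  | cond_true {σ τ : State} {e : Expr} {c d : Prog} {v : ℤ} {t : ℕ}
      (he : e.value B σ = some v) (hv : v ≠ 0) (hc : Exec B c σ t τ) :
      Exec B (.cond e c d) σ (e.cost + 1 + t) τ
  | cond_false {σ τ : State} {e : Expr} {c d : Prog} {t : ℕ}
      (he : e.value B σ = some 0) (hd : Exec B d σ t τ) :
      Exec B (.cond e c d) σ (e.cost + 1 + t) τ
  | loop_true {σ τ ρ : State} {e : Expr} {c : Prog} {v : ℤ} {s t : ℕ}
      (he : e.value B σ = some v) (hv : v ≠ 0) (hc : Exec B c σ s τ)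
      (hl : Exec B (.loop e c) τ t ρ) :
      Exec B (.loop e c) σ (e.cost + 1 + s + t) ρ
  | loop_false {σ : State} {e : Expr} {c : Prog} (he : e.value B σ = some 0) :
      Exec B (.loop e c) σ (e.cost + 1) σ

/-- Runs are deterministic: the final state and the running time are unique. -/
theorem Exec.unique {B : ℕ} {c : Prog} {σ τ τ' : State} {t t' : ℕ}
    (h : Exec B c σ t τ) (h' : Exec B c σ t' τ') : t = t' ∧ τ = τ' := by
  induction h generalizing t' τ' with
  | skip => cases h'; simp
  | assign he => cases h'; simp_all
  | store hi hj he => cases h'; simp_all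
  | seq hc hd ihc ihd =>
    cases h' with
    | seq hc' hd' =>
      obtain ⟨rfl, rfl⟩ := ihc hc'
      obtain ⟨rfl, rfl⟩ := ihd hd'
      simp
  | cond_true he hv hc ih =>
    cases h' with
    | cond_true he' hv' hc' => obtain ⟨rfl, rfl⟩ := ih hc'; simp
    | cond_false he' hd' => simp_all
  | cond_false he hd ih =>
    cases h' with
    | cond_true he' hv' hc' => simp_all
    | cond_false he' hd' => obtain ⟨rfl, rfl⟩ := ih hd'; simp
  | loop_true he hv hc hl ihc ihl =>
    cases h' with
    | loop_true he' hv' hc' hl' =>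
      obtain ⟨rfl, rfl⟩ := ihc hc'
      obtain ⟨rfl, rfl⟩ := ihl hl'
      simp
    | loop_false he' => simp_all
  | loop_false he =>
    cases h' with
    | loop_true he' hv' hc' hl' => simp_all
    | loop_false he' => simp

/-- The initial state on input `S`: variable `0` holds the length of `S`, the cells `0, 1, ...` of
array `0` hold the letters of `S`, and everything else is `0`. -/
def inputState (S : List ℤ) : State where
  var x := if x = 0 then (S.length : ℤ) else 0
  arr a i := if a = 0 then S.getD i 0 else 0

/-- The output of the state `τ` is the list `L`: variable `1` holds the length of `L`, and the
cells `0, 1, ...` of array `1` hold its entries. -/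
def HasOutput (τ : State) (L : List ℕ) : Prop :=
  τ.var 1 = L.length ∧ ∀ (i : ℕ) (_ : i < L.length), τ.arr 1 i = (L[i] : ℤ)

end OpPeriods

/-!
An integer `p` with `1 ≤ p < n` is an initial op-period of `S` exactly if, at every multiple
`i < n` of `p`, the block of length `p` starting at `i` (cut off at the end of `S`) is
order-equivalent to a prefix of `S`: density of `ℚ` allows the last block to be completed
(`isInitialOpPeriod_iff`). Hence, if `z i` is the length of the longest factor at position `i` that is
order-equivalent to a prefix, and `f i` is `z i`, replaced by `n` when the factor reaches the end of
`S`, then `p` is an initial op-period iff `p ≤ f i` for all multiples `i ≥ 1` of `p`.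

The table `z` is computed in linear time by the Z-algorithm (`runs_prefixLengths`), which works for
order-equivalence because that relation is transitive and inherited by factors. Extending an
order-equivalence by one letter takes constant time, since it suffices to compare the new letter with
its two neighbours in value among the preceding letters (`SameOrder.succ_iff`). These neighbours are
found by deleting the positions from right to left from a doubly linked list of all positions sorted
by value (`IsLinked.delete`, `IsLinked.exists_isNeighbours`). The sorting is a radix sort in base
`n + 2` (`runs_sortByDigit`, `rk_mod_mul`), which needs a constant number of passes when the letters
are bounded by `(n + 2) ^ k`. The keys `(a + M) * (n + 2) + i`, for the letter `a` at position `i`, are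
distinct, and the identity already sorts them modulo `n + 2`.

The minima of `f` over the multiples of every `p` are computed along the sieve of Eratosthenes: for
each prime `q`, the entry at `j` is replaced by its minimum with the entry at `j * q`, from right to
left (`leOnMultiples_succ_of_prime`). This takes `n / q` steps for each prime `q < n`, in total
`O(n log log n)` by an upper bound of Mertens' type for the sum of the reciprocals of the primes,
which follows from the bound `4 ^ n` for the primorial by splitting dyadically
(`sum_inv_primes_le`, `sum_div_primes_isBigO`).

The program is verified by weakest preconditions for loop-free code and by invariants with potentials
for loops (`Prog.wp`, `Runs.loop`); that a piece of code leaves the other variables and arrays alone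
is read off its syntax (`Exec.frame`).
-/

namespace OpPeriods

/-! ### Total correctness with running times -/

/-- The value of a word operation as a total function (division by zero has value `0`). -/
def BinOp.eval : BinOp → ℤ → ℤ → ℤ
  | .add, a, b => a + b
  | .sub, a, b => a - b
  | .mul, a, b => a * b
  | .div, a, b => a / b
  | .mod, a, b => a % b
  | .lt, a, b => if a < b then 1 else 0
  | .le, a, b => if a ≤ b then 1 else 0
  | .eq, a, b => if a = b then 1 else 0

/-- The value of an expression as a total function, without any range check. -/
def Expr.val (σ : State) : Expr → ℤ
  | .lit c => c
  | .var x => σ.var x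
  | .read a e => σ.arr a (e.val σ).toNat
  | .op o e f => o.eval (e.val σ) (f.val σ)

/-- The condition on the divisor under which a word operation is defined. -/
def BinOp.Safe : BinOp → ℤ → Prop
  | .div, b => b ≠ 0
  | .mod, b => b ≠ 0
  | _, _ => True

/-- `v` is a word for the bound `B`; a form of `|v| ≤ B` that suits linear arithmetic. -/
def Fits (B : ℕ) (v : ℤ) : Prop := -(B : ℤ) ≤ v ∧ v ≤ B

/-- Evaluating the expression does not get stuck: all intermediate values are words, no divisor is
zero, and no address is negative. -/
def Expr.Ok (B : ℕ) (σ : State) : Expr → Prop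
  | .lit c => Fits B c
  | .var x => Fits B (σ.var x)
  | .read a e => e.Ok B σ ∧ 0 ≤ e.val σ ∧ Fits B (σ.arr a (e.val σ).toNat)
  | .op o e f => e.Ok B σ ∧ f.Ok B σ ∧ o.Safe (f.val σ) ∧ Fits B (o.eval (e.val σ) (f.val σ))

theorem word_eq_some {B : ℕ} {v : ℤ} (h : Fits B v) : word B v = some v :=
  if_pos (abs_le.2 h)

theorem Expr.value_eq_some {B : ℕ} {σ : State} {e : Expr} (h : e.Ok B σ) :
    e.value B σ = some (e.val σ) := by
  induction e with
  | lit c => exact word_eq_some h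
  | var x => exact word_eq_some h
  | read a e ih =>
    obtain ⟨h1, h2, h3⟩ := h
    simp [Expr.value, ih h1, h2, word_eq_some h3, Expr.val]
  | op o e f ihe ihf =>
    obtain ⟨h1, h2, h3, h4⟩ := h
    have hs : o.apply (e.val σ) (f.val σ) = some (o.eval (e.val σ) (f.val σ)) := by
      cases o <;> simp_all [BinOp.apply, BinOp.eval, BinOp.Safe]
    simp [Expr.value, ihe h1, ihf h2, hs, word_eq_some h4, Expr.val]

/-- Whether the program contains an assignment to variable `x`. -/
def Prog.writesVar (x : ℕ) : Prog → Bool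
  | .skip => false
  | .assign y _ => y == x
  | .store _ _ _ => false
  | .seq c d => c.writesVar x || d.writesVar x
  | .cond _ c d => c.writesVar x || d.writesVar x
  | .loop _ c => c.writesVar x

/-- Whether the program contains a store to array `a`. -/
def Prog.writesArr (a : ℕ) : Prog → Bool
  | .skip => false
  | .assign _ _ => false
  | .store b _ _ => b == a
  | .seq c d => c.writesArr a || d.writesArr a
  | .cond _ c d => c.writesArr a || d.writesArr a
  | .loop _ c => c.writesArr a

/-- The states agree on all variables and arrays that the program `c` does not mention as targets
of assignments. -/
structure Frame (c : Prog) (σ τ : State) : Prop where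
  var : ∀ x, c.writesVar x = false → τ.var x = σ.var x
  arr : ∀ a, c.writesArr a = false → τ.arr a = σ.arr a

theorem Frame.refl (c : Prog) (σ : State) : Frame c σ σ := ⟨fun _ _ => rfl, fun _ _ => rfl⟩

theorem Frame.trans {c : Prog} {σ τ ρ : State} (h : Frame c σ τ) (h' : Frame c τ ρ) :
    Frame c σ ρ :=
  ⟨fun x hx => (h'.var x hx).trans (h.var x hx), fun a ha => (h'.arr a ha).trans (h.arr a ha)⟩

theorem Frame.mono {c d : Prog} {σ τ : State} (h : Frame c σ τ)
    (hv : ∀ x, d.writesVar x = false → c.writesVar x = false)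
    (ha : ∀ a, d.writesArr a = false → c.writesArr a = false) : Frame d σ τ :=
  ⟨fun x hx => h.var x (hv x hx), fun a hx => h.arr a (ha a hx)⟩

theorem Exec.frame {B : ℕ} {c : Prog} {σ τ : State} {t : ℕ} (h : Exec B c σ t τ) :
    Frame c σ τ := by
  induction h with
  | skip => exact Frame.refl _ _
  | assign he =>
    refine ⟨fun y hy => ?_, fun a _ => rfl⟩
    simp only [Prog.writesVar, beq_eq_false_iff_ne] at hy
    exact Function.update_of_ne (Ne.symm hy) _ _
  | store hi hj he =>
    refine ⟨fun y hy => rfl, fun b hb => ?_⟩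
    simp only [Prog.writesArr, beq_eq_false_iff_ne] at hb
    exact Function.update_of_ne (Ne.symm hb) _ _
  | seq hc hd ihc ihd =>
    exact (ihc.mono (by simp [Prog.writesVar]; tauto) (by simp [Prog.writesArr]; tauto)).trans
      (ihd.mono (by simp [Prog.writesVar]) (by simp [Prog.writesArr]))
  | cond_true he hv hc ih =>
    exact ih.mono (by simp [Prog.writesVar]; tauto) (by simp [Prog.writesArr]; tauto)
  | cond_false he hd ih => exact ih.mono (by simp [Prog.writesVar]) (by simp [Prog.writesArr])
  | loop_true he hv hc hl ihc ihl =>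
    exact Frame.trans (c := .loop _ _) (ihc.mono (fun _ h => h) (fun _ h => h)) ihl
  | loop_false he => exact Frame.refl _ _

/-- Started in `σ`, the program halts within `T` units of time in a state satisfying `Q`. -/
def Runs (B : ℕ) (c : Prog) (σ : State) (T : ℕ) (Q : State → Prop) : Prop :=
  ∃ t τ, Exec B c σ t τ ∧ t ≤ T ∧ Q τ

theorem Runs.mono {B : ℕ} {c : Prog} {σ : State} {T T' : ℕ} {Q Q' : State → Prop}
    (h : Runs B c σ T Q) (hT : T ≤ T') (hQ : ∀ τ, Q τ → Frame c σ τ → Q' τ) :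
    Runs B c σ T' Q' := by
  obtain ⟨t, τ, h1, h2, h3⟩ := h
  exact ⟨t, τ, h1, h2.trans hT, hQ τ h3 h1.frame⟩

theorem Runs.seq {B : ℕ} {c d : Prog} {σ : State} {T T' : ℕ} {P Q : State → Prop}
    (h : Runs B c σ T P) (h' : ∀ τ, P τ → Frame c σ τ → Runs B d τ T' Q) :
    Runs B (.seq c d) σ (T + T') Q := by
  obtain ⟨t, τ, h1, h2, h3⟩ := h
  obtain ⟨t', ρ, h4, h5, h6⟩ := h' τ h3 h1.frame
  exact ⟨t + t', ρ, .seq h1 h4, by omega, h6⟩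

theorem Runs.assign_seq {B : ℕ} {x : ℕ} {e : Expr} {d : Prog} {σ : State} {T : ℕ}
    {Q : State → Prop} (he : e.Ok B σ) (h : Runs B d (σ.setVar x (e.val σ)) T Q) :
    Runs B (.seq (.assign x e) d) σ (e.cost + 1 + T) Q := by
  obtain ⟨t, τ, h1, h2, h3⟩ := h
  exact ⟨_, τ, .seq (.assign (Expr.value_eq_some he)) h1, by omega, h3⟩

theorem Runs.cond {B : ℕ} {c d : Prog} {e : Expr} {σ : State} {T : ℕ} {Q : State → Prop}
    (he : e.Ok B σ) (hc : e.val σ ≠ 0 → Runs B c σ T Q) (hd : e.val σ = 0 → Runs B d σ T Q) :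
    Runs B (.cond e c d) σ (T + e.cost + 1) Q := by
  have he := Expr.value_eq_some he
  by_cases h0 : e.val σ = 0
  · obtain ⟨t, τ, h1, h2, h3⟩ := hd h0
    exact ⟨_, τ, .cond_false (h0 ▸ he) h1, by omega, h3⟩
  · obtain ⟨t, τ, h1, h2, h3⟩ := hc h0
    exact ⟨_, τ, .cond_true he h0 h1, by omega, h3⟩

/-- Loops are verified with an invariant `I p σ` in which `p` is a potential that pays for all the
remaining iterations. -/
theorem Runs.loop {B : ℕ} {e : Expr} {c : Prog} {σ : State} (I : ℕ → State → Prop) {p : ℕ}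
    (hok : ∀ p τ, I p τ → Frame (.loop e c) σ τ → e.Ok B τ)
    (hstep : ∀ p τ, I p τ → Frame (.loop e c) σ τ → e.val τ ≠ 0 →
      ∃ T p', T + e.cost + 1 + p' ≤ p ∧ Runs B c τ T (I p'))
    (h : I p σ) :
    Runs B (.loop e c) σ (p + e.cost + 1) (fun τ => (∃ p', I p' τ) ∧ e.val τ = 0) := by
  have key : ∀ p τ, I p τ → Frame (.loop e c) σ τ →
      Runs B (.loop e c) τ (p + e.cost + 1) (fun τ => (∃ p', I p' τ) ∧ e.val τ = 0) := by
    intro p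
    induction p using Nat.strong_induction_on with
    | _ p ih =>
      intro τ hI hF
      have he := Expr.value_eq_some (hok p τ hI hF)
      by_cases h0 : e.val τ = 0
      · exact ⟨_, τ, .loop_false (h0 ▸ he), by omega, ⟨p, hI⟩, h0⟩
      · obtain ⟨T, p', hp, t, ρ, h1, h2, h3⟩ := hstep p τ hI hF h0
        obtain ⟨t', υ, h4, h5, h6⟩ := ih p' (by omega) ρ h3
          (hF.trans (h1.frame.mono (fun _ h => h) (fun _ h => h)))
        exact ⟨_, υ, .loop_true he h0 h1 h4, by omega, h6⟩
  exact key p σ h (Frame.refl _ _)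

/-- A loop of exactly `m` iterations, the `i`-th of which takes at most `C i` units of time. -/
theorem Runs.iterate {B : ℕ} {e : Expr} {c : Prog} {σ : State} (I : ℕ → State → Prop) (m : ℕ)
    (C : ℕ → ℕ)
    (hcond : ∀ i ≤ m, ∀ τ, I i τ → Frame (.loop e c) σ τ → e.Ok B τ ∧ (e.val τ ≠ 0 ↔ i < m))
    (hstep : ∀ i < m, ∀ τ, I i τ → Frame (.loop e c) σ τ → Runs B c τ (C i) (I (i + 1)))
    (h : I 0 σ) :
    Runs B (.loop e c) σ (∑ i ∈ Finset.range m, (C i + e.cost + 1) + e.cost + 1) (I m) := by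
  have hsum : ∀ i < m, ∑ j ∈ Finset.Ico i m, (C j + e.cost + 1) =
      (C i + e.cost + 1) + ∑ j ∈ Finset.Ico (i + 1) m, (C j + e.cost + 1) := fun i hi =>
    Finset.sum_eq_sum_Ico_succ_bot hi _
  have key := Runs.loop (B := B) (e := e) (c := c) (σ := σ)
    (fun p τ => ∃ i ≤ m, I i τ ∧ p = ∑ j ∈ Finset.Ico i m, (C j + e.cost + 1))
    (p := ∑ j ∈ Finset.Ico 0 m, (C j + e.cost + 1))
    (fun p τ ⟨i, hi, hI, hp⟩ hF => (hcond i hi τ hI hF).1)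
    (fun p τ ⟨i, hi, hI, hp⟩ hF h0 => by
      have hlt := (hcond i hi τ hI hF).2.1 h0
      refine ⟨C i, _, (hp.trans (hsum i hlt)).ge, ?_⟩
      exact (hstep i hlt τ hI hF).mono le_rfl fun ρ hρ _ => ⟨i + 1, hlt, hρ, rfl⟩)
    ⟨0, by omega, h, rfl⟩
  obtain ⟨t, τ, h1, h2, ⟨p', i, hi, hI, _⟩, h4⟩ := key
  have him : i = m := by
    by_contra hne
    exact (hcond i hi τ hI h1.frame).2.2 (by omega) h4
  refine ⟨t, τ, h1, ?_, him ▸ hI⟩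
  rwa [Finset.range_eq_Ico]

/-- The time of the program when every loop body and every loop test is counted once; for a loop-free
program, an upper bound of its running time. -/
def Prog.steps : Prog → ℕ
  | .skip => 1
  | .assign _ e => e.cost + 1
  | .store _ i e => i.cost + e.cost + 1
  | .seq c d => c.steps + d.steps
  | .cond e c d => c.steps + d.steps + e.cost + 1
  | .loop e c => c.steps + e.cost + 1

/-- The weakest precondition of a loop-free program. -/
def Prog.wp (B : ℕ) : Prog → (State → Prop) → State → Prop
  | .skip, Q, σ => Q σ
  | .assign x e, Q, σ => e.Ok B σ ∧ Q (σ.setVar x (e.val σ))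
  | .store a i e, Q, σ =>
      i.Ok B σ ∧ 0 ≤ i.val σ ∧ e.Ok B σ ∧ Q (σ.setArr a (i.val σ).toNat (e.val σ))
  | .seq c d, Q, σ => c.wp B (d.wp B Q) σ
  | .cond e c d, Q, σ => e.Ok B σ ∧ (e.val σ ≠ 0 → c.wp B Q σ) ∧ (e.val σ = 0 → d.wp B Q σ)
  | .loop _ _, _, _ => False

theorem Runs.of_wp {B : ℕ} {c : Prog} {σ : State} {Q : State → Prop} (h : c.wp B Q σ) :
    Runs B c σ c.steps Q := by
  induction c generalizing σ Q with
  | skip => exact ⟨1, σ, .skip σ, le_rfl, h⟩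
  | assign x e => exact ⟨_, _, .assign (Expr.value_eq_some h.1), le_rfl, h.2⟩
  | store a i e =>
    exact ⟨_, _, .store (Expr.value_eq_some h.1) h.2.1 (Expr.value_eq_some h.2.2.1), le_rfl,
      h.2.2.2⟩
  | seq c d ihc ihd => exact (ihc h).seq fun τ hτ _ => ihd hτ
  | cond e c d ihc ihd =>
    exact .cond h.1 (fun h0 => (ihc (h.2.1 h0)).mono (by omega) fun _ h _ => h)
      (fun h0 => (ihd (h.2.2 h0)).mono (by omega) fun _ h _ => h)
  | loop e c => exact h.elim

/-- The program, whose loops are not nested and take at most `m` iterations each, halts in a state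
satisfying `Q`. -/
def RunsLin (B m : ℕ) (c : Prog) (σ : State) (Q : State → Prop) : Prop :=
  Runs B c σ (c.steps * (m + 1)) Q

theorem RunsLin.of_wp {B m : ℕ} {c : Prog} {σ : State} {Q : State → Prop} (h : c.wp B Q σ) :
    RunsLin B m c σ Q :=
  (Runs.of_wp h).mono (Nat.le_mul_of_pos_right _ (Nat.succ_pos m)) fun _ h _ => h

theorem RunsLin.seq {B m : ℕ} {c d : Prog} {σ : State} {P Q : State → Prop}
    (h : RunsLin B m c σ P) (h' : ∀ τ, P τ → Frame c σ τ → RunsLin B m d τ Q) :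
    RunsLin B m (.seq c d) σ Q :=
  (Runs.seq h h').mono (by simp only [Prog.steps]; rw [add_mul]) fun _ h _ => h

theorem RunsLin.assign_seq {B m : ℕ} {x : ℕ} {e : Expr} {d : Prog} {σ : State} {Q : State → Prop}
    (he : e.Ok B σ) (h : RunsLin B m d (σ.setVar x (e.val σ)) Q) :
    RunsLin B m (.seq (.assign x e) d) σ Q :=
  RunsLin.seq (P := fun τ => τ = σ.setVar x (e.val σ)) (.of_wp ⟨he, rfl⟩) fun _ hτ _ => hτ ▸ h

theorem RunsLin.loop {B M : ℕ} {e : Expr} {c : Prog} {σ : State} (I : ℕ → State → Prop) (m : ℕ)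
    (hm : m ≤ M)
    (hcond : ∀ i ≤ m, ∀ τ, I i τ → Frame (.loop e c) σ τ → e.Ok B τ ∧ (e.val τ ≠ 0 ↔ i < m))
    (hstep : ∀ i < m, ∀ τ, I i τ → Frame (.loop e c) σ τ → c.wp B (I (i + 1)) τ)
    (h : I 0 σ) :
    RunsLin B M (.loop e c) σ (I m) := by
  refine (Runs.iterate I m (fun _ => c.steps) hcond
    (fun i hi τ hI hF => .of_wp (hstep i hi τ hI hF)) h).mono ?_ fun _ h _ => h
  simp only [Finset.sum_const, Finset.card_range, smul_eq_mul, Prog.steps]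
  nlinarith [Nat.mul_le_mul_left (c.steps + e.cost + 1) hm]

theorem RunsLin.mono {B m : ℕ} {c : Prog} {σ : State} {Q Q' : State → Prop}
    (h : RunsLin B m c σ Q) (hQ : ∀ τ, Q τ → Frame c σ τ → Q' τ) : RunsLin B m c σ Q' :=
  Runs.mono h le_rfl hQ

/-! ### Order-equivalence of factors -/

/-- The factors of length `m` of `s` starting at `i` and at `i'` are order-equivalent. -/
def SameOrder (s : ℕ → ℤ) (i i' m : ℕ) : Prop :=
  ∀ u < m, ∀ v < m, s (i + u) < s (i + v) ↔ s (i' + u) < s (i' + v)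

theorem SameOrder.mono {s : ℕ → ℤ} {i i' m m' : ℕ} (h : SameOrder s i i' m) (hm : m' ≤ m) :
    SameOrder s i i' m' :=
  fun u hu v hv => h u (by omega) v (by omega)

theorem SameOrder.symm {s : ℕ → ℤ} {i i' m : ℕ} (h : SameOrder s i i' m) : SameOrder s i' i m :=
  fun u hu v hv => (h u hu v hv).symm

theorem SameOrder.trans {s : ℕ → ℤ} {i i' i'' m : ℕ} (h : SameOrder s i i' m)
    (h' : SameOrder s i' i'' m) : SameOrder s i i'' m :=
  fun u hu v hv => (h u hu v hv).trans (h' u hu v hv)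

theorem SameOrder.shift {s : ℕ → ℤ} {i i' m : ℕ} (h : SameOrder s i i' m) (d : ℕ) :
    SameOrder s (i + d) (i' + d) (m - d) := fun u hu v hv => by
  simpa [add_assoc] using h (d + u) (by omega) (d + v) (by omega)

theorem OrderEquiv.symm {α : Type*} [LT α] {X Y : List α} (h : OrderEquiv X Y) :
    OrderEquiv Y X :=
  ⟨h.1.symm, fun i j hi hj hi' hj' => (h.2 i j hi' hj' hi hj).symm⟩

theorem OrderEquiv.trans {α : Type*} [LT α] {X Y Z : List α} (h : OrderEquiv X Y)
    (h' : OrderEquiv Y Z) : OrderEquiv X Z :=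
  ⟨h.1.trans h'.1, fun i j hi hj hi' hj' =>
    (h.2 i j hi hj (h.1 ▸ hi) (h.1 ▸ hj)).trans (h'.2 i j (h.1 ▸ hi) (h.1 ▸ hj) hi' hj')⟩

theorem OrderEquiv.refl {α : Type*} [LT α] (X : List α) : OrderEquiv X X :=
  ⟨rfl, fun _ _ _ _ _ _ => Iff.rfl⟩

/-- A string that is order-equivalent to a proper prefix of `Y` can be extended by a rational letter,
by density of the rationals. -/
theorem exists_orderEquiv_append_singleton (X Y : List ℚ) (hlt : X.length < Y.length)
    (h : OrderEquiv X (Y.take X.length)) :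
    ∃ x, OrderEquiv (X ++ [x]) (Y.take (X.length + 1)) := by
  set m := X.length with hm
  have hX : ∀ i j (hi : i < m) (hj : j < m), X[i] < X[j] ↔ Y[i] < Y[j] := fun i j hi hj => by
    have := h.2 i j hi hj (by simp; omega) (by simp; omega)
    simpa only [List.getElem_take] using this
  suffices hx : ∃ x, ∀ i (hi : i < m), (X[i] < x ↔ Y[i] < Y[m]) ∧ (x < X[i] ↔ Y[m] < Y[i]) by
    obtain ⟨x, hx⟩ := hx
    refine ⟨x, by simp; omega, fun i j hi hj hi' hj' => ?_⟩
    simp only [List.length_append, List.length_singleton] at hi hj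
    simp only [List.getElem_take]
    rcases Nat.lt_succ_iff_lt_or_eq.1 hi with hi | rfl <;>
    rcases Nat.lt_succ_iff_lt_or_eq.1 hj with hj | rfl
    · simpa [List.getElem_append, hi, hj] using hX i j hi hj
    · simpa [List.getElem_append, hi, hm] using (hx i hi).1
    · simpa [List.getElem_append, hj, hm] using (hx j hj).2
    · simp
  by_cases heq : ∃ j, ∃ hj : j < m, Y[j] = Y[m]
  · obtain ⟨j, hj, hjm⟩ := heq
    exact ⟨X[j], fun i hi => ⟨by rw [hX i j hi hj, hjm], by rw [hX j i hj hi, hjm]⟩⟩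
  · push Not at heq
    let lo : Finset ℚ := (Finset.univ.filter fun i : Fin m => Y[i.1] < Y[m]).image fun i => X[i.1]
    let hi : Finset ℚ := (Finset.univ.filter fun i : Fin m => Y[m] < Y[i.1]).image fun i => X[i.1]
    obtain ⟨x, hlo, hhi⟩ := Order.exists_between_finsets lo hi (by
      simp only [lo, hi, Finset.mem_image, Finset.mem_filter, Finset.mem_univ, true_and]
      rintro _ ⟨i, hi, rfl⟩ _ ⟨j, hj, rfl⟩
      exact (hX i j i.2 j.2).2 (hi.trans hj))
    have h1 : ∀ i (hi : i < m), Y[i] < Y[m] → X[i] < x := fun i hi hlt =>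
      hlo _ (Finset.mem_image.2 ⟨⟨i, hi⟩, by simpa using hlt, rfl⟩)
    have h2 : ∀ i (hi : i < m), Y[m] < Y[i] → x < X[i] := fun i hi hlt =>
      hhi _ (Finset.mem_image.2 ⟨⟨i, hi⟩, by simpa using hlt, rfl⟩)
    refine ⟨x, fun i hi => ?_⟩
    rcases lt_or_gt_of_ne (heq i hi) with hc | hc
    · exact ⟨iff_of_true (h1 i hi hc) hc, iff_of_false (h1 i hi hc).not_gt hc.not_gt⟩
    · exact ⟨iff_of_false (h2 i hi hc).not_gt hc.not_gt, iff_of_true (h2 i hi hc) hc⟩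

theorem exists_orderEquiv_append (Y : List ℚ) (d : ℕ) (X : List ℚ)
    (hd : X.length + d = Y.length) (h : OrderEquiv X (Y.take X.length)) :
    ∃ Z, OrderEquiv (X ++ Z) Y := by
  induction d generalizing X with
  | zero =>
    refine ⟨[], ?_⟩
    rw [List.append_nil]
    rwa [List.take_of_length_le (by omega)] at h
  | succ d ih =>
    obtain ⟨x, hx⟩ := exists_orderEquiv_append_singleton X Y (by omega) h
    obtain ⟨Z, hZ⟩ := ih (X ++ [x]) (by simp; omega) (by simpa using hx)
    exact ⟨x :: Z, by simpa using hZ⟩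

/-- In a concatenation of blocks of length `p`, position `p * u` is the start of a block. -/
theorem exists_block_of_flatten {α : Type*} {p : ℕ} {Vs : List (List α)}
    (h : ∀ V ∈ Vs, V.length = p) {u : ℕ} (hu : p * u < Vs.flatten.length) :
    ∃ V ∈ Vs, ∀ j < p, Vs.flatten[p * u + j]? = V[j]? := by
  induction Vs generalizing u with
  | nil => simp at hu
  | cons W Vs ih =>
    have hW := h W (by simp)
    cases u with
    | zero =>
      refine ⟨W, by simp, fun j hj => ?_⟩
      simp [List.getElem?_append, hW, hj]
    | succ u =>
      simp only [List.flatten_cons, List.length_append, hW, mul_add, mul_one] at hu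
      obtain ⟨V, hV, hVj⟩ := ih (fun V hV => h V (by simp [hV])) (u := u) (by omega)
      refine ⟨V, by simp [hV], fun j hj => ?_⟩
      rw [← hVj j hj, List.flatten_cons, List.getElem?_append_right (by rw [hW]; lia), hW]
      congr 1
      lia

/-- A string all of whose blocks of length `p`, including an incomplete last one, are
order-equivalent to prefixes of `V` is a prefix of a concatenation of strings order-equivalent
to `V`. -/
theorem exists_append_eq_flatten {p : ℕ} (hp : 0 < p) (V : List ℚ) (hV : V.length = p)
    (R : List ℚ)
    (h : ∀ u, p * u < R.length →
      OrderEquiv ((R.drop (p * u)).take p) (V.take (min p (R.length - p * u)))) :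
    ∃ (Vs : List (List ℚ)) (B : List ℚ), (∀ W ∈ Vs, OrderEquiv W V) ∧ R ++ B = Vs.flatten := by
  induction hn : R.length using Nat.strong_induction_on generalizing R with
  | _ n ih =>
    rcases Nat.eq_zero_or_pos n with rfl | hpos
    · exact ⟨[], [], by simp, by simpa using hn⟩
    have h0 := h 0 (by omega)
    simp only [mul_zero, List.drop_zero, Nat.sub_zero] at h0
    have hlen : (R.take p).length = min p R.length := by simp
    obtain ⟨Z, hZ⟩ := exists_orderEquiv_append V (p - min p R.length) (R.take p)
      (by rw [hlen, hV]; omega) (by rwa [hlen])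
    by_cases hle : n ≤ p
    · refine ⟨[R.take p ++ Z], Z, by simpa using hZ, ?_⟩
      simp [List.take_of_length_le (hn.trans_le hle)]
    · have hZ0 : Z = [] := by
        have := hZ.1
        rw [List.length_append, hlen, hV] at this
        exact List.length_eq_zero_iff.1 (by omega)
      subst hZ0
      obtain ⟨Vs, B, h1, h2⟩ := ih (n - p) (by omega) (R.drop p) (fun u hu => by
        rw [List.length_drop] at hu
        have := h (u + 1) (by rw [mul_add]; omega)
        rw [List.drop_drop, List.length_drop]
        rw [mul_add, mul_one, add_comm (p * u) p] at this
        rwa [Nat.sub_sub]) (by simp [hn])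
      refine ⟨R.take p :: Vs, B, ?_, ?_⟩
      · simp only [List.append_nil] at hZ
        simpa [hZ] using h1
      · rw [List.flatten_cons, ← h2, ← List.append_assoc, List.take_append_drop]

theorem isInitialOpPeriod_iff (S : List ℤ) (p : ℕ) :
    IsInitialOpPeriod S p ↔ 0 < p ∧ p < S.length ∧ ∀ u, p * u < S.length →
      SameOrder (fun i => S.getD i 0) 0 (p * u) (min p (S.length - p * u)) := by
  set n := S.length with hn
  have hcast : ∀ i, i < n → (S.map (fun z : ℤ => (z : ℚ)))[i]? = some ((S.getD i 0 : ℤ) : ℚ) :=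
    fun i hi => by simp [List.getElem?_map, List.getElem?_eq_getElem (hn ▸ hi)]
  constructor
  · rintro ⟨hp, hpn, V₁, Vs, hlen, hequiv, A, B, hflat, hA⟩
    refine ⟨hp, hpn, fun u hu => ?_⟩
    rw [List.flatten_cons, List.append_assoc] at hflat
    have hflat := (List.append_inj hflat (by have := hlen V₁ (by simp); omega)).2
    have hblock : ∀ u, p * u < n → ∃ V ∈ Vs, ∀ j < p, p * u + j < n →
        V[j]? = some ((S.getD (p * u + j) 0 : ℤ) : ℚ) := fun u hu => by
      obtain ⟨V, hV, hVj⟩ := exists_block_of_flatten (p := p) (Vs := Vs)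
        (fun V hV => hlen V (by simp [hV])) (u := u) (by rw [← hflat]; simp; omega)
      refine ⟨V, hV, fun j hj hjn => ?_⟩
      rw [← hVj j hj, ← hflat, List.getElem?_append_left (by simp; omega), hcast _ hjn]
    obtain ⟨V, hV, hVj⟩ := hblock 0 (by omega)
    obtain ⟨W, hW, hWj⟩ := hblock u hu
    intro a ha b hb
    have hVl := hlen V (by simp [hV])
    have hWl := hlen W (by simp [hW])
    have key := (hequiv V (by simp [hV]) W (by simp [hW])).2 a b (by omega) (by omega)
      (by omega) (by omega)
    have e1 := hVj a (by omega) (by omega)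
    have e2 := hVj b (by omega) (by omega)
    have e3 := hWj a (by omega) (by omega)
    have e4 := hWj b (by omega) (by omega)
    rw [List.getElem?_eq_getElem (by omega), Option.some.injEq] at e1 e2 e3 e4
    rw [e1, e2, e3, e4, Int.cast_lt, Int.cast_lt] at key
    simpa using key
  · rintro ⟨hp, hpn, h⟩
    set R := S.map (fun z : ℤ => (z : ℚ)) with hR
    have hRl : R.length = n := by simp [hR, hn]
    have hRg : ∀ i (hi : i < R.length), R[i] = ((S.getD i 0 : ℤ) : ℚ) := fun i hi => by
      have := hcast i (by omega)
      rwa [List.getElem?_eq_getElem hi, Option.some.injEq] at this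
    obtain ⟨Vs, B, h1, h2⟩ := exists_append_eq_flatten hp (R.take p) (by simp; omega) R
      (fun u hu => by
        refine ⟨by simp, fun i j hi hj hi' hj' => ?_⟩
        simp only [List.length_take, List.length_drop] at hi hj
        simp only [List.getElem_take, List.getElem_drop, hRg, Int.cast_lt]
        have := h u (by omega) i (by omega) j (by omega)
        simp only [zero_add] at this
        exact this.symm)
    have hmem : ∀ V ∈ R.take p :: Vs, OrderEquiv V (R.take p) := by
      simpa [OrderEquiv.refl] using h1
    exact ⟨hp, hpn, R.take p, Vs, fun V hV => (hmem V hV).1.trans (by simp; omega),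
      fun V hV W hW => (hmem V hV).trans (hmem W hW).symm, R.take p, B,
      by rw [List.flatten_cons, List.append_assoc, h2], by simp; omega⟩

/-! ### The longest prefix order-equivalent to a factor -/

/-- `z` is the length of the longest factor at position `i` of `s` (restricted to the first `n`
letters) that is order-equivalent to a prefix of `s`. -/
def IsPrefLen (s : ℕ → ℤ) (n i z : ℕ) : Prop :=
  i + z ≤ n ∧ SameOrder s 0 i z ∧ (i + z < n → ¬ SameOrder s 0 i (z + 1))

theorem exists_isPrefLen (s : ℕ → ℤ) {n i : ℕ} (hi : i ≤ n) : ∃ z, IsPrefLen s n i z := by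
  by_contra hno
  have hall : ∀ z, i + z ≤ n ∧ SameOrder s 0 i z := by
    intro z
    induction z with
    | zero => exact ⟨hi, fun u hu => by omega⟩
    | succ z ih =>
      by_contra hz
      exact hno ⟨z, ih.1, ih.2, fun hlt h => hz ⟨hlt, h⟩⟩
  have := (hall (n + 1)).1
  omega

theorem IsPrefLen.le_iff {s : ℕ → ℤ} {n i z m : ℕ} (h : IsPrefLen s n i z) (hm : i + m ≤ n) :
    m ≤ z ↔ SameOrder s 0 i m := by
  refine ⟨fun hmz => h.2.1.mono hmz, fun hs => ?_⟩
  by_contra hlt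
  exact h.2.2 (by omega) (hs.mono (by omega))

/-- Two positions compare in the same way after a shift by `i`. -/
def SameCmp (s : ℕ → ℤ) (i a j : ℕ) : Prop :=
  (s a < s j ↔ s (i + a) < s (i + j)) ∧ (s j < s a ↔ s (i + j) < s (i + a))

/-- Among the positions before `j`, position `a` carries a largest letter not exceeding that of `j`
and `c` a smallest letter not below it. Here `a = j` or `c = j` encodes that there is none. -/
def IsNeighbours (s : ℕ → ℤ) (j a c : ℕ) : Prop :=
  a ≤ j ∧ c ≤ j ∧ s a ≤ s j ∧ s j ≤ s c ∧
    ∀ u < j, (a < j ∧ s u ≤ s a) ∨ (c < j ∧ s c ≤ s u)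

/-- An order-equivalence of prefixes extends by one letter if the new letter compares correctly with
its two neighbours in value. -/
theorem SameOrder.succ_iff {s : ℕ → ℤ} {i j a c : ℕ} (h : SameOrder s 0 i j)
    (hn : IsNeighbours s j a c) :
    SameOrder s 0 i (j + 1) ↔ SameCmp s i a j ∧ SameCmp s i c j := by
  obtain ⟨ha, hc, hsa, hsc, hu⟩ := hn
  simp only [SameOrder, zero_add] at h ⊢
  constructor
  · intro h'
    exact ⟨⟨h' a (by omega) j (by omega), h' j (by omega) a (by omega)⟩,
      ⟨h' c (by omega) j (by omega), h' j (by omega) c (by omega)⟩⟩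
  · rintro ⟨⟨h1, h2⟩, ⟨h3, h4⟩⟩
    have key : ∀ u < j, (s u < s j ↔ s (i + u) < s (i + j)) ∧
        (s j < s u ↔ s (i + j) < s (i + u)) := fun u huj => by
      rcases hu u huj with ⟨haj, hua⟩ | ⟨hcj, hcu⟩
      · have h5 := h a haj u huj
        have h6 := h u huj a haj
        constructor <;> constructor <;> intro <;> omega
      · have h5 := h c hcj u huj
        have h6 := h u huj c hcj
        constructor <;> constructor <;> intro <;> omega
    intro u hu v hv
    rcases Nat.lt_succ_iff_lt_or_eq.1 hu with hu | rfl <;>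
    rcases Nat.lt_succ_iff_lt_or_eq.1 hv with hv | rfl
    · exact h u hu v hv
    · exact (key u hu).1
    · exact (key v hv).2
    · simp

/-- The reuse step of the Z-algorithm: if the factor of length `w` at `l` is order-equivalent to a
prefix, then the prefix length at `l + d` is known to be `z` when `z < w - d`. -/
theorem IsPrefLen.of_box {s : ℕ → ℤ} {n l w d z : ℕ} (hb : SameOrder s 0 l w) (hw : l + w ≤ n)
    (hz : IsPrefLen s n d z) (hlt : d + z < w) : IsPrefLen s n (l + d) z := by
  have hs := hb.shift d
  rw [zero_add] at hs
  refine ⟨by omega, hz.2.1.trans (hs.mono (by omega)), fun _ h => ?_⟩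
  rcases Nat.eq_zero_or_pos l with rfl | hl
  · exact hz.2.2 (by omega) (by simpa using h)
  · exact hz.2.2 (by omega) (h.trans (hs.mono (by omega)).symm)

/-! ### Ranks and the digit step of radix sort -/

/-- The rank of `i` when the indices below `n` are sorted by `y`. -/
def rk (y : ℕ → ℕ) (n i : ℕ) : ℕ := ((Finset.range n).filter fun i' => y i' < y i).card

theorem rk_lt {y : ℕ → ℕ} {n i : ℕ} (hi : i < n) : rk y n i < n := by
  have : rk y n i < (Finset.range n).card := Finset.card_lt_card (by
    refine Finset.ssubset_iff_subset_ne.2 ⟨Finset.filter_subset _ _, fun h => ?_⟩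
    have := h.ge (Finset.mem_range.2 hi)
    simp at this)
  simpa using this

theorem rk_lt_rk {y : ℕ → ℕ} {n i i' : ℕ} (hi : i < n) (h : y i < y i') :
    rk y n i < rk y n i' := by
  refine Finset.card_lt_card (Finset.ssubset_iff_subset_ne.2 ⟨fun j hj => ?_, fun he => ?_⟩)
  · simp only [Finset.mem_filter] at hj ⊢
    exact ⟨hj.1, hj.2.trans h⟩
  · have := he.ge (Finset.mem_filter.2 ⟨Finset.mem_range.2 hi, h⟩)
    simp at this

theorem rk_lt_rk_iff {y : ℕ → ℕ} {n i i' : ℕ} (hi : i < n) (hi' : i' < n) :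
    rk y n i < rk y n i' ↔ y i < y i' := by
  refine ⟨fun h => ?_, rk_lt_rk hi⟩
  rcases lt_trichotomy (y i) (y i') with h1 | h1 | h1
  · exact h1
  · simp [rk, h1] at h
  · exact absurd (rk_lt_rk hi' h1) (by omega)

theorem exists_inverse_rk {y : ℕ → ℕ} {n : ℕ} (hy : ∀ i < n, ∀ i' < n, y i = y i' → i = i') :
    ∃ π : ℕ → ℕ, (∀ t < n, π t < n ∧ rk y n (π t) = t) ∧ ∀ i < n, π (rk y n i) = i := by
  have hinj : ∀ i < n, ∀ i' < n, rk y n i = rk y n i' → i = i' := fun i hi i' hi' h => by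
    refine hy i hi i' hi' (le_antisymm ?_ ?_) <;> by_contra hlt
    · have := rk_lt_rk (n := n) hi' (not_le.1 hlt); omega
    · have := rk_lt_rk (n := n) hi (not_le.1 hlt); omega
  have hsurj : ∀ t, ∃ i, t < n → i < n ∧ rk y n i = t := fun t => by
    by_cases ht : t < n
    · obtain ⟨i, hi, h⟩ := Finset.surj_on_of_inj_on_of_card_le (s := Finset.range n)
        (t := Finset.range n) (fun i _ => rk y n i)
        (fun i hi => Finset.mem_range.2 (rk_lt (Finset.mem_range.1 hi)))
        (fun i i' hi hi' h => hinj i (Finset.mem_range.1 hi) i' (Finset.mem_range.1 hi') h)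
        le_rfl t (Finset.mem_range.2 ht)
      exact ⟨i, fun _ => ⟨Finset.mem_range.1 hi, h.symm⟩⟩
    · exact ⟨0, fun h => absurd h ht⟩
  choose π hπ using hsurj
  exact ⟨π, hπ, fun i hi => hinj _ (hπ _ (rk_lt hi)).1 i hi (hπ _ (rk_lt hi)).2⟩

/-- Number of indices below `n` at which the function `d` takes the value `v`. -/
def cnt (d : ℕ → ℕ) (n v : ℕ) : ℕ := ((Finset.range n).filter fun i => d i = v).card

/-- Number of indices below `n` at which the function `d` takes a value below `v`. -/
def cntLt (d : ℕ → ℕ) (n v : ℕ) : ℕ := ((Finset.range n).filter fun i => d i < v).card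

theorem cnt_succ (d : ℕ → ℕ) (n v : ℕ) :
    cnt d (n + 1) v = cnt d n v + if d n = v then 1 else 0 := by
  unfold cnt
  rw [Finset.range_add_one, Finset.filter_insert]
  split_ifs with h
  · rw [Finset.card_insert_of_notMem (by simp)]
  · rfl

theorem cntLt_succ (d : ℕ → ℕ) (n v : ℕ) : cntLt d n (v + 1) = cntLt d n v + cnt d n v := by
  unfold cntLt cnt
  rw [← Finset.card_union_of_disjoint, ← Finset.filter_or]
  · congr 1
    ext i
    simp only [Finset.mem_filter, Finset.mem_range]
    omega
  · rw [Finset.disjoint_filter]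
    intros
    omega

theorem cntLt_zero (d : ℕ → ℕ) (n : ℕ) : cntLt d n 0 = 0 := by simp [cntLt]

theorem cnt_le (d : ℕ → ℕ) (n v : ℕ) : cnt d n v ≤ n :=
  (Finset.card_filter_le _ _).trans (by simp)

theorem cntLt_le (d : ℕ → ℕ) (n v : ℕ) : cntLt d n v ≤ n :=
  (Finset.card_filter_le _ _).trans (by simp)

/-- Distributing the indices, in the order given by the residues modulo `P`, stably into buckets by
their next digit sorts them by the residues modulo `P * N`. -/
theorem rk_mod_mul {x : ℕ → ℕ} {P N n : ℕ} (hP : 0 < P) {π : ℕ → ℕ}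
    (hπ : ∀ t < n, π t < n ∧ rk (fun i => x i % P) n (π t) = t)
    (hπ' : ∀ i < n, π (rk (fun i => x i % P) n i) = i) {i : ℕ} (hi : i < n) :
    rk (fun i => x i % (P * N)) n i = cntLt (fun i => x i / P % N) n (x i / P % N) +
      cnt (fun t => x (π t) / P % N) (rk (fun i => x i % P) n i) (x i / P % N) := by
  have hb : cnt (fun t => x (π t) / P % N) (rk (fun i => x i % P) n i) (x i / P % N) =
      ((Finset.range n).filter fun i' => x i' / P % N = x i / P % N ∧ x i' % P < x i % P).card := by
    refine Finset.card_nbij' π (rk (fun i => x i % P) n) ?_ ?_ ?_ ?_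
    · intro t ht
      simp only [Finset.coe_filter, Set.mem_ofPred_eq, Finset.mem_range] at ht ⊢
      have htn := hπ t (ht.1.trans (rk_lt hi))
      refine ⟨htn.1, ht.2, ?_⟩
      rw [← rk_lt_rk_iff (y := fun i => x i % P) htn.1 hi, htn.2]
      exact ht.1
    · intro i' hi'
      simp only [Finset.coe_filter, Set.mem_ofPred_eq, Finset.mem_range] at hi' ⊢
      rw [hπ' i' hi'.1]
      exact ⟨(rk_lt_rk_iff hi'.1 hi).2 hi'.2.2, hi'.2.1⟩
    · intro t ht
      simp only [Finset.coe_filter, Set.mem_ofPred_eq, Finset.mem_range] at ht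
      exact (hπ t (ht.1.trans (rk_lt hi))).2
    · intro i' hi'
      simp only [Finset.coe_filter, Set.mem_ofPred_eq, Finset.mem_range] at hi'
      exact hπ' i' hi'.1
  rw [hb, rk, cntLt, ← Finset.card_union_of_disjoint, ← Finset.filter_or]
  · congr 1
    refine Finset.filter_congr fun i' _ => ?_
    rw [Nat.mod_mul, Nat.mod_mul]
    have h1 := Nat.mod_lt (x i') hP
    have h2 := Nat.mod_lt (x i) hP
    constructor
    · intro h
      by_contra! hc
      rcases hc.1.lt_or_eq with hlt | heq
      · have := Nat.mul_le_mul_left P hlt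
        rw [Nat.succ_eq_add_one, mul_add] at this
        omega
      · have := hc.2 heq.symm
        rw [heq] at h
        omega
    · rintro (hlt | ⟨heq, hlt⟩)
      · have := Nat.mul_le_mul_left P hlt
        rw [Nat.succ_eq_add_one, mul_add] at this
        omega
      · rw [heq]
        omega
  · rw [Finset.disjoint_filter]
    intros
    omega

/-! ### Minima over multiples -/

/-- The threshold `v` is at most `f` at all multiples `j * u < n` of `j` for which every prime factor
of `u` is less than `q`. -/
def LeOnMultiples (f : ℕ → ℕ) (n q v j : ℕ) : Prop :=
  ∀ u, 1 ≤ u → (∀ p, p.Prime → p ∣ u → p < q) → j * u < n → v ≤ f (j * u)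

theorem leOnMultiples_two {f : ℕ → ℕ} {n v j : ℕ} (hj : j < n) :
    LeOnMultiples f n 2 v j ↔ v ≤ f j := by
  refine ⟨fun h => by simpa using h 1 le_rfl (fun p hp hd => absurd (Nat.dvd_one.1 hd) hp.ne_one) (by simpa using hj),
    fun h u hu hp _ => ?_⟩
  have hu1 : u = 1 := by
    by_contra hne
    exact absurd (hp _ (Nat.minFac_prime hne) (Nat.minFac_dvd u))
      (not_lt.2 (Nat.minFac_prime hne).two_le)
  simpa [hu1] using h

theorem leOnMultiples_succ_of_not_prime {f : ℕ → ℕ} {n q v j : ℕ} (hq : ¬ q.Prime) :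
    LeOnMultiples f n (q + 1) v j ↔ LeOnMultiples f n q v j := by
  have : ∀ u, (∀ p, p.Prime → p ∣ u → p < q + 1) ↔ (∀ p, p.Prime → p ∣ u → p < q) := fun u =>
    ⟨fun h p hp hd => lt_of_le_of_ne (Nat.lt_succ_iff.1 (h p hp hd)) fun he => hq (he ▸ hp),
      fun h p hp hd => (h p hp hd).trans (Nat.lt_succ_self q)⟩
  simp only [LeOnMultiples, this]

/-- The recursion of the sieve: a multiplier is either free of the prime `q`, or `q` can be split
off. -/
theorem leOnMultiples_succ_of_prime {f : ℕ → ℕ} {n q v j : ℕ} (hq : q.Prime) :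
    LeOnMultiples f n (q + 1) v j ↔
      LeOnMultiples f n q v j ∧ (j * q < n → LeOnMultiples f n (q + 1) v (j * q)) := by
  constructor
  · refine fun h => ⟨fun u hu hp hlt => h u hu (fun p h1 h2 => (hp p h1 h2).trans
      (Nat.lt_succ_self q)) hlt, fun _ u hu hp hlt => ?_⟩
    rw [mul_assoc] at hlt ⊢
    refine h (q * u) (Nat.mul_pos hq.pos hu) (fun p h1 h2 => ?_) hlt
    rcases h1.dvd_mul.1 h2 with h3 | h3
    · rw [(Nat.prime_dvd_prime_iff_eq h1 hq).1 h3]; omega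
    · exact hp p h1 h3
  · rintro ⟨h1, h2⟩ u hu hp hlt
    by_cases hd : q ∣ u
    · obtain ⟨w, rfl⟩ := hd
      have hw : 1 ≤ w := Nat.pos_of_mul_pos_left hu
      rw [← mul_assoc] at hlt ⊢
      exact h2 (lt_of_le_of_lt (Nat.le_mul_of_pos_right _ hw) hlt) w hw
        (fun p h3 h4 => hp p h3 (h4.mul_left q)) hlt
    · refine h1 u hu (fun p h3 h4 => lt_of_le_of_ne (Nat.lt_succ_iff.1 (hp p h3 h4)) ?_) hlt
      rintro rfl
      exact hd h4

theorem leOnMultiples_iff_forall {f : ℕ → ℕ} {n q v j : ℕ} (hj : 1 ≤ j) (hq : n ≤ q) :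
    LeOnMultiples f n q v j ↔ ∀ u, 1 ≤ u → j * u < n → v ≤ f (j * u) := by
  refine ⟨fun h u hu hlt => h u hu (fun p _ hd => ?_) hlt, fun h u hu _ hlt => h u hu hlt⟩
  have h1 := Nat.le_of_dvd hu hd
  have h2 := Nat.le_mul_of_pos_left u hj
  omega

/-! ### The sum of the reciprocals of the primes -/

theorem card_primes_dyadic (k : ℕ) :
    k * ((Finset.Ico (2 ^ k) (2 ^ (k + 1))).filter Nat.Prime).card ≤ 2 ^ (k + 2) := by
  have h1 : (2 ^ k) ^ ((Finset.Ico (2 ^ k) (2 ^ (k + 1))).filter Nat.Prime).card ≤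
      ∏ p ∈ (Finset.Ico (2 ^ k) (2 ^ (k + 1))).filter Nat.Prime, p :=
    Finset.pow_card_le_prod _ _ _ fun p hp =>
      (Finset.mem_Ico.1 (Finset.mem_filter.1 hp).1).1
  have h2 : ∏ p ∈ (Finset.Ico (2 ^ k) (2 ^ (k + 1))).filter Nat.Prime, p ≤
      primorial (2 ^ (k + 1)) := by
    refine Finset.prod_le_prod_of_subset_of_one_le' (fun p hp => ?_) fun p hp _ => ?_
    · simp only [Finset.mem_filter, Finset.mem_Ico, Finset.mem_range] at hp ⊢
      exact ⟨by omega, hp.2⟩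
    · exact (Finset.mem_filter.1 hp).2.one_lt.le
  have h3 := (h1.trans h2).trans (primorial_le_four_pow _)
  rw [← pow_mul, show (4 : ℕ) = 2 ^ 2 from rfl, ← pow_mul] at h3
  have h4 := (Nat.pow_le_pow_iff_right (by norm_num : 1 < 2)).1 h3
  calc _ ≤ 2 * 2 ^ (k + 1) := h4
    _ = 2 ^ (k + 2) := by ring

theorem sum_inv_primes_dyadic (k : ℕ) :
    ∑ p ∈ (Finset.Ico (2 ^ (k + 1)) (2 ^ (k + 2))).filter Nat.Prime, (1 / p : ℝ) ≤
      4 * (((k + 1 : ℕ) : ℝ))⁻¹ := by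
  have h1 : ∑ p ∈ (Finset.Ico (2 ^ (k + 1)) (2 ^ (k + 2))).filter Nat.Prime, (1 / p : ℝ) ≤
      ((Finset.Ico (2 ^ (k + 1)) (2 ^ (k + 2))).filter Nat.Prime).card • (1 / 2 ^ (k + 1) : ℝ) := by
    refine Finset.sum_le_card_nsmul _ _ _ fun p hp => ?_
    have := (Finset.mem_Ico.1 (Finset.mem_filter.1 hp).1).1
    exact one_div_le_one_div_of_le (by positivity) (by exact_mod_cast this)
  refine h1.trans ?_
  have h2 := card_primes_dyadic (k + 1)
  have h3 : (((k + 1 : ℕ) : ℝ)) *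
      ((Finset.Ico (2 ^ (k + 1)) (2 ^ (k + 2))).filter Nat.Prime).card ≤ 2 ^ (k + 3) := by
    exact_mod_cast h2
  rw [nsmul_eq_mul, mul_one_div, div_le_iff₀ (by positivity), ← div_eq_mul_inv, div_mul_eq_mul_div,
    le_div_iff₀ (by positivity), mul_comm]
  exact h3.trans (le_of_eq (by ring))

/-- An upper bound of Mertens' type: the reciprocals of the primes below `2 ^ (m + 1)` sum up to
`O(log m)`. -/
theorem sum_inv_primes_le (m : ℕ) :
    ∑ p ∈ (Finset.range (2 ^ (m + 1))).filter Nat.Prime, (1 / p : ℝ) ≤ 4 * (1 + Real.log m) := by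
  have key : ∑ p ∈ (Finset.range (2 ^ (m + 1))).filter Nat.Prime, (1 / p : ℝ) ≤
      4 * ∑ k ∈ Finset.range m, (((k + 1 : ℕ) : ℝ))⁻¹ := by
    induction m with
    | zero =>
      rw [Finset.sum_eq_zero]
      · simp
      · intro p hp
        simp only [Finset.mem_filter, Finset.mem_range] at hp
        have := hp.2.two_le
        omega
    | succ m ih =>
      have hun : (Finset.range (2 ^ (m + 1 + 1))).filter Nat.Prime =
          (Finset.range (2 ^ (m + 1))).filter Nat.Prime ∪
            (Finset.Ico (2 ^ (m + 1)) (2 ^ (m + 2))).filter Nat.Prime := by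
        rw [← Finset.filter_union]
        congr 1
        ext p
        simp only [Finset.mem_union, Finset.mem_range, Finset.mem_Ico, pow_succ]
        omega
      rw [hun, Finset.sum_range_succ, mul_add, Finset.sum_union]
      swap
      · refine Finset.disjoint_left.2 fun p hp hp' => ?_
        simp only [Finset.mem_filter, Finset.mem_range, Finset.mem_Ico] at hp hp'
        omega
      exact add_le_add ih (sum_inv_primes_dyadic m)
  refine key.trans ?_
  have := harmonic_le_one_add_log m
  rw [harmonic] at this
  push_cast at this ⊢
  linarith

/-- Bound for the number of steps of a sieve over the primes. -/
theorem sum_div_primes_isBigO :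
    (fun n : ℕ => ((∑ p ∈ (Finset.range n).filter Nat.Prime, n / p : ℕ) : ℝ)) =O[Filter.atTop]
      fun n : ℕ => (n : ℝ) * Real.log (Real.log (n : ℝ)) := by
  refine Asymptotics.IsBigO.of_bound 12 ?_
  have hlarge : ∀ᶠ n : ℕ in Filter.atTop, (4 : ℝ) ≤ Real.log n :=
    (Real.tendsto_log_atTop.comp tendsto_natCast_atTop_atTop).eventually_ge_atTop 4
  filter_upwards [hlarge, Filter.eventually_gt_atTop 1] with n hn hn1
  have hlog4 : 1 ≤ Real.log (Real.log n) := by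
    rw [Real.le_log_iff_exp_le (by linarith)]
    have := Real.exp_one_lt_d9
    linarith
  have h1 : ((∑ p ∈ (Finset.range n).filter Nat.Prime, n / p : ℕ) : ℝ) ≤
      n * ∑ p ∈ (Finset.range n).filter Nat.Prime, (1 / p : ℝ) := by
    rw [Nat.cast_sum, Finset.mul_sum]
    refine Finset.sum_le_sum fun p _ => ?_
    rw [mul_one_div]
    exact Nat.cast_div_le
  have h2 : ∑ p ∈ (Finset.range n).filter Nat.Prime, (1 / p : ℝ) ≤
      4 * (1 + Real.log (Nat.log 2 n)) := by
    refine le_trans (Finset.sum_le_sum_of_subset_of_nonneg ?_ fun _ _ _ => by positivity)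
      (sum_inv_primes_le (Nat.log 2 n))
    refine Finset.filter_subset_filter _ (Finset.range_subset_range.2 ?_)
    exact (Nat.lt_pow_succ_log_self (by norm_num) n).le
  have h3 : Real.log (Nat.log 2 n) ≤ 2 * Real.log (Real.log n) := by
    have hpos : (0 : ℝ) < Nat.log 2 n := by exact_mod_cast Nat.log_pos (by norm_num) hn1
    have h4 : (Nat.log 2 n : ℝ) * Real.log 2 ≤ Real.log n := by
      rw [← Real.log_pow]
      refine Real.log_le_log (by positivity) ?_
      exact_mod_cast Nat.pow_log_le_self 2 (by omega)
    have h5 := Real.log_two_gt_d9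
    have h6 : (Nat.log 2 n : ℝ) ≤ Real.log n ^ 2 := by nlinarith
    calc Real.log (Nat.log 2 n) ≤ Real.log (Real.log n ^ 2) := Real.log_le_log hpos h6
      _ = 2 * Real.log (Real.log n) := by rw [Real.log_pow]; norm_num
  rw [Real.norm_of_nonneg (by positivity), Real.norm_of_nonneg (by positivity)]
  calc _ ≤ _ := h1
    _ ≤ n * (4 * (1 + 2 * Real.log (Real.log n))) := by gcongr; linarith
    _ ≤ n * (12 * Real.log (Real.log n)) :=
      mul_le_mul_of_nonneg_left (by linarith) (Nat.cast_nonneg n)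
    _ = _ := by ring

/-! ### Evaluating the expressions of a program -/

/-! Programs are written with the usual arithmetic symbols; `𝕧 x` is the variable `x`, and `𝕒 a e` is
the cell of array `a` at index `e`. -/

instance : Add Expr := ⟨.op .add⟩
instance : Sub Expr := ⟨.op .sub⟩
instance : Mul Expr := ⟨.op .mul⟩
instance : Div Expr := ⟨.op .div⟩
instance : Mod Expr := ⟨.op .mod⟩
instance (k : ℕ) : OfNat Expr k := ⟨.lit k⟩

notation "𝕧" => Expr.var
notation "𝕒" => Expr.read
infix:50 " <ₑ " => Expr.op BinOp.lt
infix:50 " ≤ₑ " => Expr.op BinOp.le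
infix:50 " =ₑ " => Expr.op BinOp.eq
infix:40 " ::= " => Prog.assign
infixr:30 " ;; " => Prog.seq

section
variable {B : ℕ} {σ : State} {e f : Expr}

@[simp] theorem val_zero : Expr.val σ 0 = 0 := rfl
@[simp] theorem val_one : Expr.val σ 1 = 1 := rfl
@[simp] theorem val_two : Expr.val σ 2 = 2 := rfl
@[simp] theorem val_var (x : ℕ) : (𝕧 x).val σ = σ.var x := rfl
@[simp] theorem val_read (a : ℕ) : (𝕒 a e).val σ = σ.arr a (e.val σ).toNat := rfl
@[simp] theorem val_add : (e + f).val σ = e.val σ + f.val σ := rfl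
@[simp] theorem val_sub : (e - f).val σ = e.val σ - f.val σ := rfl
@[simp] theorem val_mul : (e * f).val σ = e.val σ * f.val σ := rfl
@[simp] theorem val_div : (e / f).val σ = e.val σ / f.val σ := rfl
@[simp] theorem val_mod : (e % f).val σ = e.val σ % f.val σ := rfl
@[simp] theorem val_lt : (e <ₑ f).val σ = if e.val σ < f.val σ then 1 else 0 := rfl
@[simp] theorem val_le : (e ≤ₑ f).val σ = if e.val σ ≤ f.val σ then 1 else 0 := rfl
@[simp] theorem val_eq : (e =ₑ f).val σ = if e.val σ = f.val σ then 1 else 0 := rfl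

@[simp] theorem ok_zero : Expr.Ok B σ 0 := by
  change Fits B 0
  unfold Fits
  omega
theorem fits_one (hB : 2 ≤ B) : Fits B 1 := by unfold Fits; omega
@[simp] theorem ok_one (hB : 2 ≤ B) : Expr.Ok B σ 1 := fits_one hB
@[simp] theorem ok_two (hB : 2 ≤ B) : Expr.Ok B σ 2 := by
  change Fits B 2
  unfold Fits
  omega
@[simp] theorem ok_var (x : ℕ) : (𝕧 x).Ok B σ ↔ Fits B (σ.var x) := Iff.rfl
@[simp] theorem ok_read (a : ℕ) : (𝕒 a e).Ok B σ ↔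
    e.Ok B σ ∧ 0 ≤ e.val σ ∧ Fits B (σ.arr a (e.val σ).toNat) := Iff.rfl
@[simp] theorem ok_add : (e + f).Ok B σ ↔
    e.Ok B σ ∧ f.Ok B σ ∧ Fits B (e.val σ + f.val σ) := by
  change _ ∧ _ ∧ True ∧ _ ↔ _
  rw [true_and]
  rfl
@[simp] theorem ok_sub : (e - f).Ok B σ ↔
    e.Ok B σ ∧ f.Ok B σ ∧ Fits B (e.val σ - f.val σ) := by
  change _ ∧ _ ∧ True ∧ _ ↔ _
  rw [true_and]
  rfl
@[simp] theorem ok_mul : (e * f).Ok B σ ↔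
    e.Ok B σ ∧ f.Ok B σ ∧ Fits B (e.val σ * f.val σ) := by
  change _ ∧ _ ∧ True ∧ _ ↔ _
  rw [true_and]
  rfl
@[simp] theorem ok_div : (e / f).Ok B σ ↔
    e.Ok B σ ∧ f.Ok B σ ∧ f.val σ ≠ 0 ∧ Fits B (e.val σ / f.val σ) := Iff.rfl
@[simp] theorem ok_mod : (e % f).Ok B σ ↔
    e.Ok B σ ∧ f.Ok B σ ∧ f.val σ ≠ 0 ∧ Fits B (e.val σ % f.val σ) := Iff.rfl

theorem fits_ite (hB : 2 ≤ B) (p : Prop) [Decidable p] : Fits B (if p then 1 else 0) := by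
  unfold Fits
  split_ifs <;> omega

@[simp] theorem ok_lt (hB : 2 ≤ B) : (e <ₑ f).Ok B σ ↔ e.Ok B σ ∧ f.Ok B σ := by
  change _ ∧ _ ∧ True ∧ _ ↔ _
  exact ⟨fun h => ⟨h.1, h.2.1⟩, fun h => ⟨h.1, h.2, trivial, fits_ite hB _⟩⟩
@[simp] theorem ok_le (hB : 2 ≤ B) : (e ≤ₑ f).Ok B σ ↔ e.Ok B σ ∧ f.Ok B σ := by
  change _ ∧ _ ∧ True ∧ _ ↔ _
  exact ⟨fun h => ⟨h.1, h.2.1⟩, fun h => ⟨h.1, h.2, trivial, fits_ite hB _⟩⟩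
@[simp] theorem ok_eq (hB : 2 ≤ B) : (e =ₑ f).Ok B σ ↔ e.Ok B σ ∧ f.Ok B σ := by
  change _ ∧ _ ∧ True ∧ _ ↔ _
  exact ⟨fun h => ⟨h.1, h.2.1⟩, fun h => ⟨h.1, h.2, trivial, fits_ite hB _⟩⟩

@[simp] theorem setVar_var (x y : ℕ) (v : ℤ) :
    (σ.setVar x v).var y = if y = x then v else σ.var y := Function.update_apply ..
@[simp] theorem setVar_arr (x : ℕ) (v : ℤ) : (σ.setVar x v).arr = σ.arr := rfl
@[simp] theorem setArr_var (a i : ℕ) (v : ℤ) : (σ.setArr a i v).var = σ.var := rfl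
@[simp] theorem setArr_arr (a b i j : ℕ) (v : ℤ) :
    (σ.setArr a i v).arr b j = if b = a ∧ j = i then v else σ.arr b j := by
  simp only [State.setArr, Function.update_apply]
  split_ifs <;> simp_all

@[simp] theorem wp_assign (x : ℕ) (Q : State → Prop) :
    (x ::= e).wp B Q σ ↔ e.Ok B σ ∧ Q (σ.setVar x (e.val σ)) := Iff.rfl
@[simp] theorem wp_store (a : ℕ) (Q : State → Prop) :
    (Prog.store a e f).wp B Q σ ↔ e.Ok B σ ∧ 0 ≤ e.val σ ∧ f.Ok B σ ∧
      Q (σ.setArr a (e.val σ).toNat (f.val σ)) := Iff.rfl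
@[simp] theorem wp_seq (c d : Prog) (Q : State → Prop) :
    (c ;; d).wp B Q σ ↔ c.wp B (d.wp B Q) σ := Iff.rfl
@[simp] theorem wp_skip (Q : State → Prop) : Prog.skip.wp B Q σ ↔ Q σ := Iff.rfl
@[simp] theorem wp_cond (c d : Prog) (Q : State → Prop) :
    (Prog.cond e c d).wp B Q σ ↔ e.Ok B σ ∧ (e.val σ ≠ 0 → c.wp B Q σ) ∧
      (e.val σ = 0 → d.wp B Q σ) := Iff.rfl

end

/-! ### Preparing the keys -/

/-- Puts `n + 2` into variable `2` and the sum of the squares of the letters, a bound for their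
absolute values, into variable `3`. -/
def boundLetters : Prog :=
  2 ::= 𝕧 0 + 2 ;; 3 ::= 0 ;; 6 ::= 0 ;;
  .loop (𝕧 6 <ₑ 𝕧 0) (3 ::= 𝕧 3 + 𝕒 0 (𝕧 6) * 𝕒 0 (𝕧 6) ;; 6 ::= 𝕧 6 + 1)

theorem sum_sq_mono (s : ℕ → ℤ) {m n : ℕ} (h : m ≤ n) :
    ∑ i ∈ Finset.range m, s i * s i ≤ ∑ i ∈ Finset.range n, s i * s i :=
  Finset.sum_le_sum_of_subset_of_nonneg (Finset.range_subset_range.2 h)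
    fun _ _ _ => mul_self_nonneg _

theorem sum_sq_nonneg (s : ℕ → ℤ) (m : ℕ) : 0 ≤ ∑ i ∈ Finset.range m, s i * s i :=
  Finset.sum_nonneg fun _ _ => mul_self_nonneg _

theorem abs_le_mul_self (a : ℤ) : -(a * a) ≤ a ∧ a ≤ a * a := by
  constructor
  · rcases le_or_gt 0 a with h | h <;> nlinarith
  · rcases le_or_gt 1 a with h | h <;> nlinarith

theorem runs_boundLetters {B n : ℕ} {s : ℕ → ℤ} {σ : State} (hn : σ.var 0 = n)
    (hs : ∀ i, σ.arr 0 i = s i) (hB : n + 2 ≤ B)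
    (hM : ∑ i ∈ Finset.range n, s i * s i ≤ B) :
    RunsLin B n boundLetters σ fun τ =>
      τ.var 2 = n + 2 ∧ τ.var 3 = ∑ i ∈ Finset.range n, s i * s i := by
  have hB2 : 2 ≤ B := by omega
  have h1 := sum_sq_nonneg s
  refine .assign_seq (by simp [hB2, hn, Fits]; omega) (.assign_seq (by simp)
    (.assign_seq (by simp) ?_))
  refine (RunsLin.loop (fun i τ => τ.var 6 = i ∧ τ.var 3 = ∑ i ∈ Finset.range i, s i * s i) n le_rfl
    ?_ ?_ ?_).mono ?_
  · rintro i hi τ ⟨h6, h3⟩ hF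
    have h0 := hF.var 0 rfl
    simp at h0
    simp [hB2, h6, h0, hn, Fits]
    omega
  · rintro i hi τ ⟨h6, h3⟩ hF
    have h2 := sum_sq_mono s (show i + 1 ≤ n from hi)
    have h4 := sum_sq_mono s (show i ≤ n from hi.le)
    have h5 := abs_le_mul_self (s i)
    have h0 : τ.arr 0 i = s i := by rw [hF.arr 0 rfl]; simp [hs]
    have h6' := h1 i
    rw [Finset.sum_range_succ] at h2
    simp [hB2, h6, h3, Fits, h0, Finset.sum_range_succ]
    omega
  · simp
  · rintro τ ⟨h6, h3⟩ hF
    refine ⟨?_, h3⟩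
    rw [hF.var 2 rfl]
    simp [hn]

/-- Stores the keys `x_i = (s_i + M) * N + i`, which are distinct and sorted by letters, into array
`2`, their order modulo `N`, which is the identity, into array `3`, the modulus `N` into variable
`4` and an upper bound for the keys into variable `5`. -/
def initKeys : Prog :=
  4 ::= 𝕧 2 ;; 5 ::= (2 * 𝕧 3 + 1) * 𝕧 2 ;; 6 ::= 0 ;;
  .loop (𝕧 6 <ₑ 𝕧 0) (.store 2 (𝕧 6) ((𝕒 0 (𝕧 6) + 𝕧 3) * 𝕧 2 + 𝕧 6) ;;
    .store 3 (𝕧 6) (𝕧 6) ;; 6 ::= 𝕧 6 + 1)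

theorem runs_initKeys {B n : ℕ} {M : ℤ} {s : ℕ → ℤ} {σ : State} (hn : σ.var 0 = n)
    (h2 : σ.var 2 = n + 2) (h3 : σ.var 3 = M)
    (hs : ∀ i, σ.arr 0 i = s i) (hM : ∀ i < n, -M ≤ s i ∧ s i ≤ M) (hM0 : 0 ≤ M)
    (hB : (2 * M + 1) * (n + 2) ≤ B) :
    RunsLin B n initKeys σ fun τ =>
      τ.var 4 = n + 2 ∧ τ.var 5 = (2 * M + 1) * (n + 2) ∧
      ∀ i < n, τ.arr 2 i = (s i + M) * (n + 2) + i ∧ τ.arr 3 i = i := by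
  have h2M : 0 ≤ 2 * M * (n + 2) := by positivity
  have h2M' : 2 * M * 2 ≤ 2 * M * (n + 2) := mul_le_mul_of_nonneg_left (by omega) (by omega)
  rw [add_mul, one_mul] at hB ⊢
  have hB2 : 2 ≤ B := by omega
  refine .assign_seq (by simp [h2, Fits]; omega) (.assign_seq ?_ (.assign_seq (by simp) ?_))
  · simp [hB2, h2, h3, Fits, add_mul]
    omega
  refine (RunsLin.loop (fun i τ => τ.var 6 = i ∧
    ∀ j < i, τ.arr 2 j = (s j + M) * (n + 2) + j ∧ τ.arr 3 j = j) n le_rfl ?_ ?_ ?_).mono ?_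
  · rintro i hi τ ⟨h6, _⟩ hF
    have h0 := hF.var 0 rfl
    simp at h0
    simp [hB2, h6, h0, hn, Fits]
    omega
  · rintro i hi τ ⟨h6, hI⟩ hF
    have e0 : τ.arr 0 i = s i := by rw [hF.arr 0 rfl]; simp [hs]
    have e2 : τ.var 2 = n + 2 := by rw [hF.var 2 rfl]; simp [h2]
    have e3 : τ.var 3 = M := by rw [hF.var 3 rfl]; simp [h3]
    have h4 := hM i hi
    have h5 : 0 ≤ (s i + M) * (n + 2) := mul_nonneg (by omega) (by omega)
    have h7 : (s i + M) * (n + 2) ≤ 2 * M * (n + 2) :=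
      mul_le_mul_of_nonneg_right (by omega) (by omega)
    simp [hB2, h6, Fits, e0, e2, e3]
    split_ands <;> try omega
    intro j hj
    rcases hj.lt_or_eq with hj | rfl
    · simp [hj.ne, hI j hj]
    · simp
  · simp
  · rintro τ ⟨h6, hI⟩ hF
    refine ⟨?_, ?_, hI⟩
    · rw [hF.var 4 rfl]; simp [h2]
    · rw [hF.var 5 rfl]; simp [h2, h3, add_mul]

/-! ### Radix sort -/

/-- Sets the counters, the cells `0, ..., N` of array `5`, to `0`. -/
def clearCounters : Prog :=
  6 ::= 0 ;; .loop (𝕧 6 ≤ₑ 𝕧 2) (.store 5 (𝕧 6) 0 ;; 6 ::= 𝕧 6 + 1)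

theorem runs_clearCounters {B N : ℕ} {σ : State} (h2 : σ.var 2 = N) (hB : N + 2 ≤ B) :
    RunsLin B (N + 1) clearCounters σ fun τ => ∀ v ≤ N, τ.arr 5 v = 0 := by
  have hB2 : 2 ≤ B := by omega
  refine .assign_seq (by simp) ((RunsLin.loop (fun i τ => τ.var 6 = i ∧
    ∀ v < i, τ.arr 5 v = 0) (N + 1) le_rfl ?_ ?_ ?_).mono ?_)
  · rintro i hi τ ⟨h6, _⟩ hF
    have e2 : τ.var 2 = N := by rw [hF.var 2 rfl]; simp [h2]
    simp [hB2, h6, e2, Fits]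
    omega
  · rintro i hi τ ⟨h6, hI⟩ hF
    simp [hB2, h6, Fits]
    split_ands <;> try omega
    exact fun v hv hne => hI v (by omega)
  · simp
  · exact fun τ hτ _ v hv => hτ.2 v (by omega)

/-- Array `2` holds the keys `x` and the digit `x i / P % N` of the `i`-th key is `d i`, where `P`
and `N` are in the variables `4` and `2`. -/
structure HasDigits (B n N P : ℕ) (x d : ℕ → ℕ) (σ : State) : Prop where
  length : σ.var 0 = n
  base : σ.var 2 = N
  modulus : σ.var 4 = P
  modulus_pos : 0 < P
  le_base : n ≤ N
  base_le : N + 2 ≤ B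
  modulus_le : P ≤ B
  key : ∀ i < n, σ.arr 2 i = x i ∧ x i ≤ B
  digit : ∀ i < n, x i / P % N = d i ∧ d i < N

theorem HasDigits.frame {B n N P : ℕ} {x d : ℕ → ℕ} {σ τ : State} {c : Prog}
    (h : HasDigits B n N P x d σ) (hF : Frame c σ τ) (h0 : c.writesVar 0 = false)
    (h2 : c.writesVar 2 = false) (h4 : c.writesVar 4 = false) (ha : c.writesArr 2 = false) :
    HasDigits B n N P x d τ :=
  { h with
    length := (hF.var 0 h0).trans h.length
    base := (hF.var 2 h2).trans h.base
    modulus := (hF.var 4 h4).trans h.modulus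
    key := fun i hi => ⟨(congrFun (hF.arr 2 ha) i).trans (h.key i hi).1, (h.key i hi).2⟩ }

theorem HasDigits.setVar {B n N P : ℕ} {x d : ℕ → ℕ} {σ : State} (h : HasDigits B n N P x d σ)
    (v : ℤ) : HasDigits B n N P x d (σ.setVar 6 v) :=
  { h with
    length := by simp [h.length]
    base := by simp [h.base]
    modulus := by simp [h.modulus] }

/-- Counts in cell `v + 1` of array `5` the keys with digit `v`; the shift by one makes the prefix sums
count the keys with a smaller digit. -/
def countDigits : Prog :=
  6 ::= 0 ;; .loop (𝕧 6 <ₑ 𝕧 0) (7 ::= 𝕒 2 (𝕧 6) / 𝕧 4 % 𝕧 2 + 1 ;;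
    .store 5 (𝕧 7) (𝕒 5 (𝕧 7) + 1) ;; 6 ::= 𝕧 6 + 1)

theorem runs_countDigits {B n N P : ℕ} {x d : ℕ → ℕ} {σ : State}
    (h : HasDigits B n N P x d σ) (h5 : ∀ v ≤ N, σ.arr 5 v = 0) :
    RunsLin B (N + 1) countDigits σ fun τ =>
      ∀ v ≤ N, τ.arr 5 v = cnt (fun i => d i + 1) n v := by
  have hb := h.base_le
  have hB2 : 2 ≤ B := by omega
  have hnN := h.le_base
  refine .assign_seq (by simp) ((RunsLin.loop (fun i τ => τ.var 6 = i ∧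
    ∀ v ≤ N, τ.arr 5 v = cnt (fun i => d i + 1) i v) n (by omega) ?_ ?_ ?_).mono ?_)
  · rintro i hi τ ⟨h6, _⟩ hF
    replace h := (h.setVar 0).frame hF rfl rfl rfl rfl
    simp [hB2, h6, h.length, Fits]
    omega
  · rintro i hi τ ⟨h6, hI⟩ hF
    replace h := (h.setVar 0).frame hF rfl rfl rfl rfl
    obtain ⟨q, hq⟩ : ∃ q, q = x i / P := ⟨_, rfl⟩
    have hqx : q ≤ x i := hq ▸ Nat.div_le_self _ _
    have hxB := (h.key i hi).2
    have hP := h.modulus_pos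
    have hPB := h.modulus_le
    have hdN := (h.digit i hi).2
    have hq' : (x i : ℤ) / P = q := by rw [hq]; push_cast; rfl
    have hd' : (q : ℤ) % N = d i := by rw [← (h.digit i hi).1, hq]; push_cast; rfl
    have h11 := hI (d i + 1) (by omega)
    have h12 := cnt_le (fun i => d i + 1) i (d i + 1)
    simp [hB2, h6, Fits, h.base, h.modulus, (h.key i hi).1, hq', hd', h11]
    split_ands <;> try omega
    intro v hv
    rw [cnt_succ, hI v hv]
    by_cases hvd : v = d i + 1
    · simp [hvd]
    · simp [hvd, Ne.symm hvd]
  · refine ⟨by simp, fun v hv => ?_⟩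
    simp [cnt, h5 v hv]
  · exact fun τ hτ _ v hv => hτ.2 v hv

/-- Replaces the counters by their prefix sums. -/
def sumCounters : Prog :=
  6 ::= 0 ;; .loop (𝕧 6 <ₑ 𝕧 2) (.store 5 (𝕧 6 + 1) (𝕒 5 (𝕧 6 + 1) + 𝕒 5 (𝕧 6)) ;; 6 ::= 𝕧 6 + 1)

theorem runs_sumCounters {B n N P : ℕ} {x d : ℕ → ℕ} {σ : State}
    (h : HasDigits B n N P x d σ) (h5 : ∀ v ≤ N, σ.arr 5 v = cnt (fun i => d i + 1) n v) :
    RunsLin B (N + 1) sumCounters σ fun τ => ∀ v ≤ N, τ.arr 5 v = cntLt d n v := by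
  have hb := h.base_le
  have hB2 : 2 ≤ B := by omega
  have hnN := h.le_base
  refine .assign_seq (by simp) ((RunsLin.loop (fun i τ => τ.var 6 = i ∧
    ∀ v ≤ N, τ.arr 5 v = if v ≤ i then (cntLt d n v : ℤ) else cnt (fun i => d i + 1) n v)
    N (by omega) ?_ ?_ ?_).mono ?_)
  · rintro i hi τ ⟨h6, _⟩ hF
    replace h := (h.setVar 0).frame hF rfl rfl rfl rfl
    simp [hB2, h6, h.base, Fits]
    omega
  · rintro i hi τ ⟨h6, hI⟩ hF
    have h1 := hI i (by omega)
    have h2 := hI (i + 1) (by omega)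
    have h3 : cnt (fun i => d i + 1) n (i + 1) = cnt d n i := by simp [cnt]
    have h4 := cntLt_succ d n i
    have h7 := cntLt_le d n (i + 1)
    simp only [le_refl, if_true, show ¬ i + 1 ≤ i by omega, if_false, h3] at h1 h2
    simp [hB2, h6, Fits, h1, h2]
    split_ands <;> try omega
    intro v hv
    rw [hI v hv]
    by_cases hvi : v = i + 1
    · simp [hvi, h4, add_comm]
    · simp [hvi, show v ≤ i + 1 ↔ v ≤ i by omega]
  · refine ⟨by simp, fun v hv => ?_⟩
    rcases v with _ | v
    · simp [cntLt_zero, h5 0, cnt]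
    · simp [h5 _ hv]
  · exact fun τ hτ _ v hv => by simp [hτ.2 v hv, hv]

/-- Places the indices in the order given by array `3` stably into array `4`, sorted by digits. -/
def placeByDigit : Prog :=
  6 ::= 0 ;; .loop (𝕧 6 <ₑ 𝕧 0) (7 ::= 𝕒 3 (𝕧 6) ;; 8 ::= 𝕒 2 (𝕧 7) / 𝕧 4 % 𝕧 2 ;;
    .store 4 (𝕒 5 (𝕧 8)) (𝕧 7) ;; .store 5 (𝕧 8) (𝕒 5 (𝕧 8) + 1) ;; 6 ::= 𝕧 6 + 1)

/-- Here `π t` is the index at position `t` before the pass and `ρ t` its position afterwards. -/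
theorem runs_placeByDigit {B n N P : ℕ} {x d π ρ : ℕ → ℕ} {σ : State}
    (h : HasDigits B n N P x d σ) (h5 : ∀ v ≤ N, σ.arr 5 v = cntLt d n v)
    (h3 : ∀ t < n, σ.arr 3 t = π t) (hπ : ∀ t < n, π t < n)
    (hρ : ∀ t < n, ρ t = cntLt d n (d (π t)) + cnt (fun t => d (π t)) t (d (π t)))
    (hρn : ∀ t < n, ρ t < n) (hρi : ∀ t < n, ∀ t' < n, ρ t = ρ t' → t = t') :
    RunsLin B (N + 1) placeByDigit σ fun τ => ∀ t < n, τ.arr 4 (ρ t) = π t := by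
  have hb := h.base_le
  have hB2 : 2 ≤ B := by omega
  have hnN := h.le_base
  refine .assign_seq (by simp) ((RunsLin.loop (fun i τ => τ.var 6 = i ∧
    (∀ v < N, τ.arr 5 v = (cntLt d n v : ℤ) + cnt (fun t => d (π t)) i v) ∧
    ∀ t < i, τ.arr 4 (ρ t) = π t) n (by omega) ?_ ?_ ?_).mono ?_)
  · rintro i hi τ ⟨h6, _⟩ hF
    replace h := (h.setVar 0).frame hF rfl rfl rfl rfl
    simp [hB2, h6, h.length, Fits]
    omega
  · rintro i hi τ ⟨h6, hI, hJ⟩ hF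
    replace h := (h.setVar 0).frame hF rfl rfl rfl rfl
    have e3 : τ.arr 3 i = π i := by rw [hF.arr 3 rfl]; simp [h3 i hi]
    have hπi := hπ i hi
    obtain ⟨q, hq⟩ : ∃ q, q = x (π i) / P := ⟨_, rfl⟩
    have hqx : q ≤ x (π i) := hq ▸ Nat.div_le_self _ _
    have hxB := (h.key _ hπi).2
    have hP := h.modulus_pos
    have hPB := h.modulus_le
    have hdN := (h.digit _ hπi).2
    have hq' : (x (π i) : ℤ) / P = q := by rw [hq]; push_cast; rfl
    have hd' : (q : ℤ) % N = d (π i) := by rw [← (h.digit _ hπi).1, hq]; push_cast; rfl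
    have h5' : τ.arr 5 (d (π i)) = ρ i := by rw [hI _ hdN, hρ i hi]; push_cast; rfl
    have h9 := hρn i hi
    simp [hB2, h6, Fits, h.base, h.modulus, e3, (h.key _ hπi).1, hq', hd', h5']
    split_ands <;> try omega
    · intro v hv
      rw [cnt_succ, hI v hv]
      by_cases hvd : v = d (π i)
      · rw [if_pos hvd, if_pos hvd.symm, hρ i hi, hvd]
        push_cast
        ring
      · simp [hvd, Ne.symm hvd]
    · intro t ht
      rcases ht.lt_or_eq with ht | rfl
      · have : ρ t ≠ ρ i := fun he => ht.ne (hρi t (by omega) i hi he)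
        simp [this, hJ t ht]
      · simp
  · refine ⟨by simp, fun v hv => ?_, by simp⟩
    simp [cnt, h5 v hv.le]
  · exact fun τ hτ _ => hτ.2.2

/-- Copies array `4` to array `3`. -/
def copyOrder : Prog :=
  6 ::= 0 ;; .loop (𝕧 6 <ₑ 𝕧 0) (.store 3 (𝕧 6) (𝕒 4 (𝕧 6)) ;; 6 ::= 𝕧 6 + 1)

theorem runs_copyOrder {B n N : ℕ} {σ : State} (h0 : σ.var 0 = n) (hnN : n ≤ N) (hB : N + 2 ≤ B)
    (h4 : ∀ t < n, Fits B (σ.arr 4 t)) :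
    RunsLin B (N + 1) copyOrder σ fun τ => ∀ t < n, τ.arr 3 t = σ.arr 4 t := by
  have hB2 : 2 ≤ B := by omega
  refine .assign_seq (by simp) ((RunsLin.loop (fun i τ => τ.var 6 = i ∧
    ∀ t < i, τ.arr 3 t = σ.arr 4 t) n (by omega) ?_ ?_ ?_).mono ?_)
  · rintro i hi τ ⟨h6, _⟩ hF
    have e0 : τ.var 0 = n := by rw [hF.var 0 rfl]; simp [h0]
    simp [hB2, h6, e0, Fits]
    omega
  · rintro i hi τ ⟨h6, hI⟩ hF
    have e4 : τ.arr 4 i = σ.arr 4 i := by rw [hF.arr 4 rfl]; simp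
    have h4i := h4 i hi
    unfold Fits at h4i
    simp [hB2, h6, Fits, e4]
    split_ands <;> try omega
    intro t ht
    rcases ht.lt_or_eq with ht | rfl
    · simp [ht.ne, hI t ht]
    · simp
  · simp
  · exact fun τ hτ _ => hτ.2

/-- One pass of radix sort. -/
def sortByDigit : Prog :=
  clearCounters ;; countDigits ;; sumCounters ;; placeByDigit ;; copyOrder ;; 4 ::= 𝕧 4 * 𝕧 2

/-- If array `3` lists the indices sorted by the keys modulo `P`, then after the pass it lists them
sorted by the keys modulo `P * N`. -/
theorem runs_sortByDigit {B n N P : ℕ} {x : ℕ → ℕ} {σ : State} (h0 : σ.var 0 = n)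
    (h2 : σ.var 2 = N) (h4 : σ.var 4 = P) (hP : 0 < P) (hN : 0 < N) (hnN : n ≤ N)
    (hNB : N + 2 ≤ B) (hPB : P * N ≤ B) (hx : ∀ i < n, σ.arr 2 i = x i ∧ x i ≤ B)
    (hinj : ∀ i < n, ∀ i' < n, x i % P = x i' % P → i = i')
    (h3 : ∀ i < n, σ.arr 3 (rk (fun i => x i % P) n i) = i) :
    RunsLin B (N + 1) sortByDigit σ fun τ =>
      τ.var 4 = (P * N : ℕ) ∧ ∀ i < n, τ.arr 3 (rk (fun i => x i % (P * N)) n i) = i := by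
  have hPB' : P ≤ B := (Nat.le_mul_of_pos_right P hN).trans hPB
  have hd : HasDigits B n N P x (fun i => x i / P % N) σ :=
    ⟨h0, h2, h4, hP, hnN, hNB, hPB', hx, fun i hi => ⟨rfl, Nat.mod_lt _ hN⟩⟩
  obtain ⟨π, hπ, hπ'⟩ := exists_inverse_rk (y := fun i => x i % P) (n := n) hinj
  have hmod : ∀ i, x i % (P * N) % P = x i % P := fun i => Nat.mod_mul_right_mod _ _ _
  obtain ⟨π₂, hπ₂, hπ₂'⟩ := exists_inverse_rk (y := fun i => x i % (P * N)) (n := n)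
    fun i hi i' hi' he => hinj i hi i' hi' (by rw [← hmod, he, hmod])
  refine (runs_clearCounters h2 hNB).seq fun τ₁ h5 hF => ?_
  replace hd := hd.frame hF rfl rfl rfl rfl
  have e3 := hF.arr 3 rfl
  refine (runs_countDigits hd h5).seq fun τ₂ h5 hF => ?_
  replace hd := hd.frame hF rfl rfl rfl rfl
  replace e3 := (hF.arr 3 rfl).trans e3
  refine (runs_sumCounters hd h5).seq fun τ₃ h5 hF => ?_
  replace hd := hd.frame hF rfl rfl rfl rfl
  replace e3 := (hF.arr 3 rfl).trans e3
  refine (runs_placeByDigit (π := π) (ρ := fun t => rk (fun i => x i % (P * N)) n (π t)) hd h5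
    (fun t ht => ?_) (fun t ht => (hπ t ht).1) (fun t ht => ?_)
    (fun t ht => rk_lt (hπ t ht).1) (fun t ht t' ht' he => ?_)).seq fun τ₄ h5 hF => ?_
  · have := h3 (π t) (hπ t ht).1
    rwa [(hπ t ht).2, ← e3] at this
  · have := rk_mod_mul hP hπ hπ' (hπ t ht).1 (N := N)
    rwa [(hπ t ht).2] at this
  · have := congrArg π₂ he
    simp only [hπ₂' _ (hπ t ht).1, hπ₂' _ (hπ t' ht').1] at this
    rw [← (hπ t ht).2, this, (hπ t' ht').2]
  replace hd := hd.frame hF rfl rfl rfl rfl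
  have h4' : ∀ i < n, τ₄.arr 4 (rk (fun i => x i % (P * N)) n i) = i := fun i hi => by
    have := h5 _ (rk_lt hi (y := fun i => x i % P))
    rwa [hπ' i hi] at this
  refine (runs_copyOrder hd.length hnN hNB fun t ht => ?_).seq fun τ₅ h3 hF => ?_
  · have := h4' (π₂ t) (hπ₂ t ht).1
    rw [(hπ₂ t ht).2] at this
    rw [this]
    have := (hπ₂ t ht).1
    unfold Fits
    omega
  replace hd := hd.frame hF rfl rfl rfl rfl
  refine .of_wp ?_
  have hPB'' : (P : ℤ) * N ≤ B := by exact_mod_cast hPB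
  have h0PN : (0 : ℤ) ≤ (P : ℤ) * N := by positivity
  simp [hd.modulus, hd.base, Fits]
  split_ands <;> try omega
  intro i hi
  rw [h3 _ (rk_lt hi), h4' i hi]

/-- Sorts the indices by the keys in array `2`, which are less than variable `5`, digit by digit from
the least significant one; the number of passes adapts to the size of the keys. -/
def radixSort : Prog := .loop (𝕧 4 <ₑ 𝕧 5) sortByDigit

theorem runs_radixSort {B n N X r : ℕ} {x : ℕ → ℕ} {σ : State} (h0 : σ.var 0 = n)
    (h2 : σ.var 2 = N) (h4 : σ.var 4 = N) (h5 : σ.var 5 = X) (hN : 0 < N) (hnN : n ≤ N)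
    (hNB : N + 2 ≤ B) (hXB : X * N ≤ B) (hr : X ≤ N ^ (r + 1))
    (hx : ∀ i < n, σ.arr 2 i = x i ∧ x i < X) (hxN : ∀ i < n, x i % N = i)
    (h3 : ∀ i < n, σ.arr 3 i = i) :
    Runs B radixSort σ (radixSort.steps * (N + 2) * (r + 1)) fun τ =>
      ∀ i < n, τ.arr 3 (rk x n i) = i := by
  classical
  have hex : ∃ m, X ≤ N ^ (m + 1) := ⟨r, hr⟩
  -- The number of passes: the modulus before pass `j` is `N ^ (j + 1)`.
  set m := Nat.find hex with hm
  have hmX : X ≤ N ^ (m + 1) := Nat.find_spec hex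
  have hmlt : ∀ j < m, N ^ (j + 1) < X := fun j hj => not_le.1 (Nat.find_min hex hj)
  have hmr : m ≤ r := Nat.find_le (h := hex) hr
  have hXB' : X ≤ B := (Nat.le_mul_of_pos_right X hN).trans hXB
  have hxP : ∀ j, ∀ i < n, x i % N ^ (j + 1) % N = i := fun j i hi => by
    rw [pow_succ', Nat.mod_mul_right_mod, hxN i hi]
  have hmono : ∀ j, m ≤ j → X ≤ N ^ (j + 1) := fun j hj =>
    hmX.trans (Nat.pow_le_pow_right hN (by omega))
  refine (Runs.iterate (fun j τ => τ.var 4 = (N ^ (j + 1) : ℕ) ∧ N ^ (j + 1) ≤ B ∧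
    ∀ i < n, τ.arr 3 (rk (fun i => x i % N ^ (j + 1)) n i) = i) m
    (fun _ => sortByDigit.steps * (N + 2)) ?_ ?_ ?_).mono ?_ ?_
  · rintro j hj τ ⟨e4, hB4, _⟩ hF
    have e5 : τ.var 5 = X := (hF.var 5 rfl).trans h5
    have hB2 : 2 ≤ B := by omega
    have hiff : N ^ (j + 1) < X ↔ j < m :=
      ⟨fun h => by by_contra hc; exact absurd (hmono j (by omega)) (by omega), hmlt j⟩
    simp only [ok_lt hB2, ok_var, val_lt, val_var, e4, e5, Fits, Nat.cast_lt, hiff]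
    split_ands <;> omega
  · rintro j hj τ ⟨e4, hB4, e3⟩ hF
    have hlt := hmlt j hj
    have hPB : N ^ (j + 1) * N ≤ B := (Nat.mul_le_mul_right N hlt.le).trans hXB
    refine Runs.mono (runs_sortByDigit (x := x) ((hF.var 0 rfl).trans h0) ((hF.var 2 rfl).trans h2) e4
      (Nat.pow_pos hN) hN hnN hNB hPB (fun i hi => ?_) (fun i hi i' hi' he => ?_) e3) le_rfl
      fun ρ hρ _ => ⟨hρ.1, hPB, hρ.2⟩
    · exact ⟨(congrFun (hF.arr 2 rfl) i).trans (hx i hi).1, (hx i hi).2.le.trans hXB'⟩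
    · rw [← hxP j i hi, he, hxP j i' hi']
  · refine ⟨by simp [h4], by simp; omega, fun i hi => ?_⟩
    have hrk : rk (fun i => x i % N ^ (0 + 1)) n i = i := by
      have : ((Finset.range n).filter fun i' => x i' % N ^ (0 + 1) < x i % N ^ (0 + 1)) =
          Finset.range i := by
        ext i'
        simp only [zero_add, pow_one, Finset.mem_filter, Finset.mem_range]
        constructor
        · rintro ⟨h, h'⟩
          rwa [hxN i hi, hxN i' h] at h'
        · intro h
          rw [hxN i hi, hxN i' (h.trans hi)]
          exact ⟨h.trans hi, h⟩
      rw [rk, this, Finset.card_range]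
    rw [hrk, h3 i hi]
  · simp only [Finset.sum_const, Finset.card_range, smul_eq_mul, radixSort, Prog.steps]
    set c := (𝕧 4 <ₑ 𝕧 5).cost
    have e1 : sortByDigit.steps * (N + 2) + c + 1 ≤ (sortByDigit.steps + c + 1) * (N + 2) := by
      nlinarith
    calc _ ≤ m * ((sortByDigit.steps + c + 1) * (N + 2)) +
          (sortByDigit.steps + c + 1) * (N + 2) := by
          have := Nat.mul_le_mul_left m e1
          omega
      _ = (sortByDigit.steps + c + 1) * (N + 2) * (m + 1) := by ring
      _ ≤ _ := Nat.mul_le_mul_left _ (by omega)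
  · rintro τ ⟨_, _, e3⟩ _ i hi
    have : rk (fun i => x i % N ^ (m + 1)) n i = rk x n i := by
      unfold rk
      congr 1
      refine Finset.filter_congr fun i' hi' => ?_
      simp only []
      rw [Nat.mod_eq_of_lt ((hx i hi).2.trans_le hmX),
        Nat.mod_eq_of_lt ((hx i' (Finset.mem_range.1 hi')).2.trans_le hmX)]
    rw [← this, e3 i hi]

/-! ### Neighbours in value -/

/-- Inverts the sorted order: array `6` holds the ranks, counted from `1`, and array `10` the
position of each rank. -/
def invertOrder : Prog :=
  6 ::= 0 ;; .loop (𝕧 6 <ₑ 𝕧 0) (7 ::= 𝕒 3 (𝕧 6) ;; .store 6 (𝕧 7) (𝕧 6 + 1) ;;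
    .store 10 (𝕧 6 + 1) (𝕧 7) ;; 6 ::= 𝕧 6 + 1)

theorem runs_invertOrder {B n : ℕ} {π R : ℕ → ℕ} {σ : State} (h0 : σ.var 0 = n)
    (hB : n + 2 ≤ B) (h3 : ∀ t < n, σ.arr 3 t = π t)
    (hπ : ∀ t < n, π t < n ∧ R (π t) = t + 1)
    (hR : ∀ i < n, ∃ t < n, R i = t + 1 ∧ π t = i) :
    RunsLin B (n + 1) invertOrder σ fun τ =>
      ∀ i < n, τ.arr 6 i = R i ∧ τ.arr 10 (R i) = i := by
  have hB2 : 2 ≤ B := by omega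
  refine .assign_seq (by simp) ((RunsLin.loop (fun t τ => τ.var 6 = t ∧
    ∀ i < n, R i ≤ t → τ.arr 6 i = R i ∧ τ.arr 10 (R i) = i) n (by omega) ?_ ?_ ?_).mono ?_)
  · rintro t ht τ ⟨h6, _⟩ hF
    have e0 : τ.var 0 = n := by rw [hF.var 0 rfl]; simp [h0]
    simp [hB2, h6, e0, Fits]
    omega
  · rintro t ht τ ⟨h6, hI⟩ hF
    have e3 : τ.arr 3 t = π t := by rw [hF.arr 3 rfl]; simp [h3 t ht]
    have h7 := hπ t ht
    simp [hB2, h6, Fits, e3]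
    split_ands <;> try omega
    intro i hi hle
    by_cases hit : i = π t
    · simp [hit, h7.2]
    · obtain ⟨t', _, h8, h9⟩ := hR i hi
      have : R i ≠ t + 1 := fun he => hit (by rw [← h9]; congr 1; omega)
      simp [hit, this, hI i hi (by omega)]
  · refine ⟨by simp, fun i hi hle => ?_⟩
    obtain ⟨t', _, h8, _⟩ := hR i hi
    omega
  · rintro τ ⟨_, hI⟩ _ i hi
    obtain ⟨t', _, h8, _⟩ := hR i hi
    exact hI i hi (by omega)

/-- Sets up a doubly linked list of the ranks between the sentinels `0` and `n + 1`, with successors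
in array `7` and predecessors in array `8`. -/
def initLinks : Prog :=
  6 ::= 0 ;; .loop (𝕧 6 ≤ₑ 𝕧 0) (.store 7 (𝕧 6) (𝕧 6 + 1) ;; .store 8 (𝕧 6 + 1) (𝕧 6) ;;
    6 ::= 𝕧 6 + 1)

theorem runs_initLinks {B n : ℕ} {σ : State} (h0 : σ.var 0 = n) (hB : n + 2 ≤ B) :
    RunsLin B (n + 1) initLinks σ fun τ =>
      ∀ r ≤ n, τ.arr 7 r = r + 1 ∧ τ.arr 8 (r + 1) = r := by
  have hB2 : 2 ≤ B := by omega
  refine .assign_seq (by simp) ((RunsLin.loop (fun t τ => τ.var 6 = t ∧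
    ∀ r < t, τ.arr 7 r = r + 1 ∧ τ.arr 8 (r + 1) = r) (n + 1) (by omega) ?_ ?_ ?_).mono ?_)
  · rintro t ht τ ⟨h6, _⟩ hF
    have e0 : τ.var 0 = n := by rw [hF.var 0 rfl]; simp [h0]
    simp [hB2, h6, e0, Fits]
    omega
  · rintro t ht τ ⟨h6, hI⟩ hF
    simp [hB2, h6, Fits]
    split_ands <;> try omega
    intro r hr
    rcases hr.lt_or_eq with hr | rfl
    · simp [hr.ne, hI r hr]
    · simp
  · simp
  · exact fun τ hτ _ r hr => hτ.2 r (by omega)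

/-- The ranks in the linked list when only the positions below `j` are left, and the sentinels. -/
def Alive (R : ℕ → ℕ) (n j r : ℕ) : Prop := r = 0 ∨ r = n + 1 ∨ ∃ i < j, R i = r

/-- The links `nxt` and `prv` lead to the next larger and the next smaller rank in the list. -/
structure IsLinked (R : ℕ → ℕ) (n j : ℕ) (nxt prv : ℕ → ℕ) : Prop where
  next : ∀ r ≤ n, Alive R n j r →
    r < nxt r ∧ Alive R n j (nxt r) ∧ ∀ w, Alive R n j w → r < w → nxt r ≤ w
  prev : ∀ r, 1 ≤ r → Alive R n j r →
    prv r < r ∧ Alive R n j (prv r) ∧ ∀ w, Alive R n j w → w < r → w ≤ prv r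

theorem alive_succ {R : ℕ → ℕ} {n j r : ℕ} :
    Alive R n (j + 1) r ↔ Alive R n j r ∨ r = R j := by
  simp only [Alive, Nat.lt_succ_iff_lt_or_eq]
  constructor
  · rintro (h | h | ⟨i, h | rfl, h'⟩)
    · exact .inl (.inl h)
    · exact .inl (.inr (.inl h))
    · exact .inl (.inr (.inr ⟨i, h, h'⟩))
    · exact .inr h'.symm
  · rintro ((h | h | ⟨i, h, h'⟩) | h)
    · exact .inl h
    · exact .inr (.inl h)
    · exact .inr (.inr ⟨i, .inl h, h'⟩)
    · exact .inr (.inr ⟨j, .inr rfl, h.symm⟩)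

theorem IsLinked.delete {R : ℕ → ℕ} {n j : ℕ} {nxt prv : ℕ → ℕ}
    (h : IsLinked R n (j + 1) nxt prv) (hj : 1 ≤ R j ∧ R j ≤ n) (hinj : ∀ i < j, R i ≠ R j) :
    IsLinked R n j (Function.update nxt (prv (R j)) (nxt (R j)))
      (Function.update prv (nxt (R j)) (prv (R j))) := by
  have hdead : ∀ r, Alive R n j r → r ≠ R j := by
    rintro r (h | h | ⟨i, h, h'⟩)
    · omega
    · omega
    · exact h' ▸ hinj i h
  have hal : ∀ r, r ≠ R j → Alive R n (j + 1) r → Alive R n j r := fun r hr h =>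
    (alive_succ.1 h).resolve_right hr
  have hsub : ∀ r, Alive R n j r → Alive R n (j + 1) r := fun r h => alive_succ.2 (.inl h)
  have hRj : Alive R n (j + 1) (R j) := alive_succ.2 (.inr rfl)
  obtain ⟨n1, n2, n3⟩ := h.next (R j) hj.2 hRj
  obtain ⟨p1, p2, p3⟩ := h.prev (R j) hj.1 hRj
  constructor
  · intro r hr hra
    rw [Function.update_apply]
    split_ifs with hrp
    · refine ⟨by omega, hal _ (by omega) n2, fun w hw hlt => n3 w (hsub w hw) ?_⟩
      by_contra hc
      have := hdead w hw
      have := p3 w (hsub w hw) (by omega)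
      omega
    · obtain ⟨q1, q2, q3⟩ := h.next r hr (hsub r hra)
      have hne : nxt r ≠ R j := fun he => by
        have h1 := p3 r (hsub r hra) (by omega)
        have h2 := q3 _ p2 (by omega)
        omega
      exact ⟨q1, hal _ hne q2, fun w hw => q3 w (hsub w hw)⟩
  · intro r hr hra
    rw [Function.update_apply]
    split_ifs with hrp
    · refine ⟨by omega, hal _ (by omega) p2, fun w hw hlt => p3 w (hsub w hw) ?_⟩
      by_contra hc
      have := hdead w hw
      have := n3 w (hsub w hw) (by omega)
      omega
    · obtain ⟨q1, q2, q3⟩ := h.prev r hr (hsub r hra)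
      have hne : prv r ≠ R j := fun he => by
        have h1 := n3 r (hsub r hra) (by omega)
        have h2 := q3 _ n2 (by omega)
        omega
      exact ⟨q1, hal _ hne q2, fun w hw => q3 w (hsub w hw)⟩

/-- In the list of the positions up to `j`, the ranks adjacent to that of `j` belong to its neighbours
in value, a sentinel standing for a missing neighbour. -/
theorem IsLinked.exists_isNeighbours {R : ℕ → ℕ} {n j : ℕ} {nxt prv : ℕ → ℕ} {s : ℕ → ℤ}
    (h : IsLinked R n (j + 1) nxt prv) (hj : 1 ≤ R j ∧ R j ≤ n)
    (hRn : ∀ i < j, 1 ≤ R i ∧ R i ≤ n) (hinj : ∀ i < j, R i ≠ R j)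
    (hmono : ∀ i ≤ j, ∀ i' ≤ j, R i ≤ R i' → s i ≤ s i') :
    ∃ a c, IsNeighbours s j a c ∧
      ((prv (R j) = 0 ∧ a = j) ∨ (1 ≤ prv (R j) ∧ a < j ∧ R a = prv (R j))) ∧
      ((nxt (R j) = n + 1 ∧ c = j) ∨ (nxt (R j) ≤ n ∧ c < j ∧ R c = nxt (R j))) := by
  have hRj : Alive R n (j + 1) (R j) := alive_succ.2 (.inr rfl)
  obtain ⟨n1, n2, n3⟩ := h.next (R j) hj.2 hRj
  obtain ⟨p1, p2, p3⟩ := h.prev (R j) hj.1 hRj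
  obtain ⟨a, ha⟩ : ∃ a, (prv (R j) = 0 ∧ a = j) ∨ (1 ≤ prv (R j) ∧ a < j ∧ R a = prv (R j)) := by
    rcases p2 with h | h | ⟨i, hi, h⟩
    · exact ⟨j, .inl ⟨h, rfl⟩⟩
    · omega
    · rcases Nat.lt_succ_iff_lt_or_eq.1 hi with hi | rfl
      · exact ⟨i, .inr ⟨h ▸ (hRn i hi).1, hi, h⟩⟩
      · omega
  obtain ⟨c, hc⟩ : ∃ c, (nxt (R j) = n + 1 ∧ c = j) ∨
      (nxt (R j) ≤ n ∧ c < j ∧ R c = nxt (R j)) := by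
    rcases n2 with h | h | ⟨i, hi, h⟩
    · omega
    · exact ⟨j, .inl ⟨h, rfl⟩⟩
    · rcases Nat.lt_succ_iff_lt_or_eq.1 hi with hi | rfl
      · exact ⟨i, .inr ⟨h ▸ (hRn i hi).2, hi, h⟩⟩
      · omega
  refine ⟨a, c, ⟨by omega, by omega, ?_, ?_, fun u hu => ?_⟩, ha, hc⟩
  · rcases ha with ⟨_, rfl⟩ | ⟨_, h1, h2⟩
    · exact le_rfl
    · exact hmono a h1.le j le_rfl (by omega)
  · rcases hc with ⟨_, rfl⟩ | ⟨_, h1, h2⟩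
    · exact le_rfl
    · exact hmono j le_rfl c h1.le (by omega)
  · have hua : Alive R n (j + 1) (R u) := .inr (.inr ⟨u, by omega, rfl⟩)
    have hun := hRn u hu
    rcases lt_or_gt_of_ne (hinj u hu) with hlt | hlt
    · have h1 := p3 _ hua hlt
      obtain ⟨_, h2, h3⟩ := ha.resolve_left (by omega)
      exact .inl ⟨h2, hmono u hu.le a h2.le (by omega)⟩
    · have h1 := n3 _ hua hlt
      obtain ⟨_, h2, h3⟩ := hc.resolve_left (by omega)
      exact .inr ⟨h2, hmono c h2.le u hu.le (by omega)⟩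

/-- Deletes the positions from the linked list from right to left. Just before position `j` is
deleted, its neighbours in the list are stored into the arrays `9` and `11`; a missing neighbour is
represented by `j` itself, which is put at the positions of the sentinels in array `10`. -/
def findNeighbours : Prog :=
  6 ::= 𝕧 0 ;; .loop (0 <ₑ 𝕧 6) (6 ::= 𝕧 6 - 1 ;; 7 ::= 𝕒 6 (𝕧 6) ;; 8 ::= 𝕒 8 (𝕧 7) ;;
    9 ::= 𝕒 7 (𝕧 7) ;; .store 10 0 (𝕧 6) ;; .store 10 (𝕧 0 + 1) (𝕧 6) ;;
    .store 9 (𝕧 6) (𝕒 10 (𝕧 8)) ;; .store 11 (𝕧 6) (𝕒 10 (𝕧 9)) ;;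
    .store 7 (𝕧 8) (𝕧 9) ;; .store 8 (𝕧 9) (𝕧 8))

theorem runs_findNeighbours {B n : ℕ} {R : ℕ → ℕ} {s : ℕ → ℤ} {σ : State} (h0 : σ.var 0 = n)
    (hB : n + 2 ≤ B) (h6 : ∀ i < n, σ.arr 6 i = R i ∧ σ.arr 10 (R i) = i)
    (h7 : ∀ r ≤ n, σ.arr 7 r = r + 1 ∧ σ.arr 8 (r + 1) = r)
    (hRn : ∀ i < n, 1 ≤ R i ∧ R i ≤ n) (hinj : ∀ i < n, ∀ i' < n, R i = R i' → i = i')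
    (hsurj : ∀ r, 1 ≤ r → r ≤ n → ∃ i < n, R i = r)
    (hmono : ∀ i < n, ∀ i' < n, R i ≤ R i' → s i ≤ s i') :
    RunsLin B (n + 1) findNeighbours σ fun τ =>
      ∀ j < n, ∃ a c : ℕ, τ.arr 9 j = a ∧ τ.arr 11 j = c ∧ IsNeighbours s j a c := by
  have hB2 : 2 ≤ B := by omega
  have hlt_of_alive : ∀ j ≤ n, ∀ r, Alive R n j r → r ≤ n + 1 := by
    rintro j hj r (h | h | ⟨i, hi, h⟩)
    · omega
    · omega
    · have := hRn i (by omega)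
      omega
  refine .assign_seq (by simp [h0, Fits]; omega) ((RunsLin.loop (fun t τ => ∃ j, j + t = n ∧
    τ.var 6 = j ∧ (∀ i < n, τ.arr 10 (R i) = i) ∧
    (∃ nxt prv : ℕ → ℕ, (∀ r ≤ n, τ.arr 7 r = nxt r ∧ τ.arr 8 (r + 1) = prv (r + 1)) ∧
      IsLinked R n j nxt prv) ∧
    (∀ j', j ≤ j' → j' < n → ∃ a c : ℕ, τ.arr 9 j' = a ∧ τ.arr 11 j' = c ∧
      IsNeighbours s j' a c)) n (by omega) ?_ ?_ ?_).mono ?_)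
  · rintro t ht τ ⟨j, hj, e6, _⟩ hF
    simp [hB2, e6, Fits]
    omega
  · rintro t ht τ ⟨j', hj', e6, e10, ⟨nxt, prv, hl1, hl2⟩, hres⟩ hF
    obtain ⟨j, rfl⟩ : ∃ j, j' = j + 1 := ⟨j' - 1, by omega⟩
    have e0 : τ.var 0 = n := by rw [hF.var 0 rfl]; simp [h0]
    have hRj := hRn j (by omega)
    have hinj' : ∀ i < j, R i ≠ R j := fun i hi he =>
      absurd (hinj i (by omega) j (by omega) he) (by omega)
    have er : τ.arr 6 j = R j := by rw [hF.arr 6 rfl]; simp [(h6 j (by omega)).1]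
    obtain ⟨a, c, hnb, ha, hc⟩ := hl2.exists_isNeighbours (s := s) hRj
      (fun i hi => hRn i (by omega)) hinj' fun i hi i' hi' => hmono i (by omega) i' (by omega)
    have hdel := hl2.delete hRj hinj'
    have hRja : Alive R n (j + 1) (R j) := alive_succ.2 (.inr rfl)
    have n1 := (hl2.next _ hRj.2 hRja).1
    have p1 := (hl2.prev _ hRj.1 hRja).1
    have e7 := (hl1 (R j) hRj.2).1
    have e8 : τ.arr 8 (R j) = prv (R j) := by
      have := (hl1 (R j - 1) (by omega)).2
      rwa [show R j - 1 + 1 = R j by omega] at this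
    generalize hpr : prv (R j) = pr at *
    generalize hnx : nxt (R j) = nx at *
    have e10a : (if pr = n + 1 then (j : ℤ) else if pr = 0 then (j : ℤ) else τ.arr 10 pr) = a := by
      rcases ha with ⟨h1, h2⟩ | ⟨h1, h2, h3⟩
      · simp [h1, h2]
      · rw [if_neg (by omega), if_neg (by omega), ← h3, e10 a (by omega)]
    have e10c : (if nx = n + 1 then (j : ℤ) else if nx = 0 then (j : ℤ) else τ.arr 10 nx) = c := by
      rcases hc with ⟨h1, h2⟩ | ⟨h1, h2, h3⟩
      · simp [h1, h2]
      · rw [if_neg (by omega), if_neg (by omega), ← h3, e10 c (by omega)]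
    have hnx' : nx ≤ n + 1 := by omega
    simp [hB2, e6, Fits, er, e7, e8, e0, e10a, e10c]
    split_ands <;> try omega
    · intro i hi
      have := hRn i hi
      rw [if_neg (by omega), if_neg (by omega), e10 i hi]
    · refine ⟨_, _, fun r hr => ?_, hdel⟩
      simp only [Function.update_apply, hl1 r hr]
      constructor <;> split_ifs <;> rfl
    · intro j' hj1 hj2
      rcases hj1.lt_or_eq with hlt | rfl
      · simp only [if_neg hlt.ne']
        obtain ⟨a', c', h1, h2, h3⟩ := hres j' hlt hj2
        exact ⟨a', h1, c', h2, h3⟩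
      · exact ⟨a, by simp, c, by simp, hnb⟩
  · refine ⟨n, rfl, by simp [h0], fun i hi => by simp [(h6 i hi).2],
      ⟨fun r => r + 1, fun r => r - 1, fun r hr => ?_, ?_⟩, fun j' h1 h2 => by omega⟩
    · simp [h7 r hr]
    · have hall : ∀ r ≤ n + 1, Alive R n n r := fun r hr => by
        by_cases h1 : r = 0
        · exact .inl h1
        by_cases h2 : r = n + 1
        · exact .inr (.inl h2)
        · exact .inr (.inr (hsurj r (by omega) (by omega)))
      exact ⟨fun r hr _ => ⟨by omega, hall _ (by omega), fun w _ _ => by omega⟩,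
        fun r hr hra => ⟨by omega, hall _ (by have := hlt_of_alive n le_rfl r hra; omega),
          fun w _ _ => by omega⟩⟩
  · rintro τ ⟨j, hj, _, _, _, hres⟩ _ j' hj'
    exact hres j' (by omega) hj'

/-! ### The Z-algorithm for order-equivalence -/

theorem IsPrefLen.unique {s : ℕ → ℤ} {n i z z' : ℕ} (h : IsPrefLen s n i z)
    (h' : IsPrefLen s n i z') : z = z' :=
  le_antisymm ((h'.le_iff h.1).2 h.2.1) ((h.le_iff h'.1).2 h'.2.1)

/-- Tests whether the letter at position `z` in variable `9` and the one at the position stored in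
cell `z` of array `a` compare in the same way after a shift by variable `6`. -/
def sameCmpExpr (a : ℕ) : Expr :=
  ((𝕒 0 (𝕒 a (𝕧 9)) <ₑ 𝕒 0 (𝕧 9)) =ₑ (𝕒 0 (𝕧 6 + 𝕒 a (𝕧 9)) <ₑ 𝕒 0 (𝕧 6 + 𝕧 9))) *
  ((𝕒 0 (𝕧 9) <ₑ 𝕒 0 (𝕒 a (𝕧 9))) =ₑ (𝕒 0 (𝕧 6 + 𝕧 9) <ₑ 𝕒 0 (𝕧 6 + 𝕒 a (𝕧 9))))

theorem ite_one_eq_ite_one (p q : Prop) [Decidable p] [Decidable q] :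
    ((if p then (1 : ℤ) else 0) = if q then 1 else 0) ↔ (p ↔ q) := by
  split_ifs <;> simp_all

theorem ite_mul_ite_one (p q : Prop) [Decidable p] [Decidable q] :
    ((if p then (1 : ℤ) else 0) * if q then 1 else 0) = if p ∧ q then 1 else 0 := by
  split_ifs <;> simp_all

theorem ite_one_ne_zero_iff (p : Prop) [Decidable p] : (if p then (1 : ℤ) else 0) ≠ 0 ↔ p := by
  simp

theorem fits_mul_ite {B : ℕ} (hB : 2 ≤ B) (p q : Prop) [Decidable p] [Decidable q] :
    Fits B ((if p then 1 else 0) * if q then 1 else 0) := by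
  rw [ite_mul_ite_one]
  exact fits_ite hB _

instance (s : ℕ → ℤ) (i a j : ℕ) : Decidable (SameCmp s i a j) :=
  inferInstanceAs (Decidable (_ ∧ _))

theorem sameCmpExpr_spec {B n i j z x : ℕ} {s : ℕ → ℤ} {σ : State} (h0 : ∀ u, σ.arr 0 u = s u)
    (hs : ∀ u, Fits B (s u)) (h6 : σ.var 6 = i) (h9 : σ.var 9 = z) (hx : σ.arr x z = j)
    (hj : j ≤ z) (hz : i + z ≤ n) (hB : n + 2 ≤ B) :
    (sameCmpExpr x).Ok B σ ∧
      (sameCmpExpr x).val σ = (if SameCmp s i j z then 1 else 0) := by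
  have hB2 : 2 ≤ B := by omega
  have e1 : ((i : ℤ) + z).toNat = i + z := by omega
  have e2 : ((i : ℤ) + j).toNat = i + j := by omega
  have f1 : Fits B (i : ℤ) := by unfold Fits; omega
  have f2 : Fits B (j : ℤ) := by unfold Fits; omega
  have f3 : Fits B (z : ℤ) := by unfold Fits; omega
  have f4 : Fits B ((i : ℤ) + z) := by unfold Fits; omega
  have f5 : Fits B ((i : ℤ) + j) := by unfold Fits; omega
  have n1 : (0 : ℤ) ≤ (i : ℤ) + z := by omega
  have n2 : (0 : ℤ) ≤ (i : ℤ) + j := by omega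
  constructor
  · simp only [sameCmpExpr, ok_mul, ok_eq hB2, ok_lt hB2, ok_read, ok_add, ok_var, val_var, val_read,
      val_add, val_lt, val_eq, h6, h9, h0, Int.toNat_natCast, hx, e1, e2, f1, f2, f3, f4, f5, n1, n2,
      hs, fits_mul_ite hB2, Nat.cast_nonneg, and_self]
  · simp only [sameCmpExpr, val_mul, val_var, val_read, val_add, val_lt, val_eq, h6, h9, h0,
      Int.toNat_natCast, hx, e1, e2, ite_one_eq_ite_one, ite_mul_ite_one]
    rfl

/-- Increases variable `9` as long as the order-equivalence of the prefix of this length with the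
factor at the position in variable `6` can be extended by one letter. -/
def extendPrefix : Prog :=
  .loop ((𝕧 6 + 𝕧 9 <ₑ 𝕧 0) * (sameCmpExpr 9 * sameCmpExpr 11)) (9 ::= 𝕧 9 + 1)

theorem runs_extendPrefix {B n i z zf : ℕ} {s : ℕ → ℤ} {σ : State} (h0 : σ.var 0 = n)
    (hs : ∀ u, σ.arr 0 u = s u) (hsB : ∀ u, Fits B (s u))
    (hnb : ∀ j < n, ∃ a c : ℕ, σ.arr 9 j = a ∧ σ.arr 11 j = c ∧ IsNeighbours s j a c)
    (h6 : σ.var 6 = i) (hi : 1 ≤ i) (hin : i < n) (h9 : σ.var 9 = z) (hB : n + 2 ≤ B)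
    (hz : SameOrder s 0 i z) (hzn : i + z ≤ n) (hzf : IsPrefLen s n i zf) :
    Runs B extendPrefix σ (extendPrefix.steps * (zf - z + 1)) fun τ => τ.var 9 = zf := by
  have hle : z ≤ zf := (hzf.le_iff hzn).2 hz
  have hzfn := hzf.1
  have hB2 : 2 ≤ B := by omega
  refine RunsLin.mono (m := zf - z) (RunsLin.loop (fun t τ => τ.var 9 = (z + t : ℕ)) (zf - z) le_rfl
    ?_ ?_ ?_) ?_
  · rintro t ht τ e9 hF
    have e6 : τ.var 6 = i := (hF.var 6 rfl).trans h6
    have e0 : τ.var 0 = n := (hF.var 0 rfl).trans h0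
    have es : ∀ u, τ.arr 0 u = s u := fun u => by rw [hF.arr 0 rfl, hs]
    obtain ⟨a, c, h1, h2, h3⟩ := hnb (z + t) (by omega)
    rw [← hF.arr 9 rfl] at h1
    rw [← hF.arr 11 rfl] at h2
    obtain ⟨o1, v1⟩ := sameCmpExpr_spec es hsB e6 e9 h1 h3.1 (by omega) hB
    obtain ⟨o2, v2⟩ := sameCmpExpr_spec es hsB e6 e9 h2 h3.2.1 (by omega) hB
    have hso : SameOrder s 0 i (z + t) := hzf.2.1.mono (by omega)
    have hiff := hso.succ_iff h3
    have hext : i + (z + t) < n ∧ SameCmp s i a (z + t) ∧ SameCmp s i c (z + t) ↔ t < zf - z := by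
      rw [← hiff]
      constructor
      · rintro ⟨h4, h5⟩
        have := (hzf.le_iff (m := z + t + 1) (by omega)).2 h5
        omega
      · intro h4
        exact ⟨by omega, hzf.2.1.mono (by omega)⟩
    have hcast : (i : ℤ) + (z + t : ℕ) < n ↔ i + (z + t) < n := by omega
    have hval : Expr.val τ ((𝕧 6 + 𝕧 9 <ₑ 𝕧 0) * (sameCmpExpr 9 * sameCmpExpr 11)) =
        if t < zf - z then 1 else 0 := by
      simp only [val_mul, val_lt, val_add, val_var, v1, v2, e6, e9, e0, hcast,
        ite_mul_ite_one]
      exact if_congr hext rfl rfl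
    refine ⟨?_, by rw [hval, ite_one_ne_zero_iff]⟩
    simp only [ok_mul, ok_lt hB2, ok_add, ok_var, o1, o2, v1, v2, val_lt, val_mul,
      ite_mul_ite_one, fits_ite hB2, and_true]
    simp [e6, e9, e0, Fits]
    omega
  · rintro t ht τ e9 hF
    simp [hB2, e9, Fits]
    omega
  · simp [h9]
  · rintro τ e9 _
    rw [e9]
    congr 1
    omega

/-- Puts into variable `9` the length of an order-equivalent prefix that is known from the box given by the
variables `7` and `8`: the factor from position `7` to position `8` is order-equivalent to a prefix. -/
def reusePrefix : Prog :=
  9 ::= 0 ;; .cond (𝕧 6 <ₑ 𝕧 8) (9 ::= 𝕒 12 (𝕧 6 - 𝕧 7) ;;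
    .cond (𝕧 8 - 𝕧 6 <ₑ 𝕧 9) (9 ::= 𝕧 8 - 𝕧 6) .skip) .skip

/-- The state of the Z-algorithm before position `i` is treated: the lengths for the positions before
`i` are in array `12`, and `[l, r)` is the current box. Array `14` holds, for every position, the
largest `p ≤ n` such that the block of length `p` at this position, cut off at the end of the string,
is order-equivalent to a prefix. -/
structure BoxInv (s : ℕ → ℤ) (n i l r : ℕ) (σ : State) : Prop where
  pos : σ.var 6 = i
  left : σ.var 7 = l
  right : σ.var 8 = r
  one_le : 1 ≤ i
  le_length : r ≤ n
  box : i < r → 1 ≤ l ∧ l < i ∧ SameOrder s 0 l (r - l)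
  table : ∀ i', 1 ≤ i' → i' < i → ∃ z : ℕ, IsPrefLen s n i' z ∧ σ.arr 12 i' = z ∧
    σ.arr 14 i' = (if i' + z = n then n else z : ℕ)

/-- The inequality says that the iterations needed to extend the known prefix are paid for by
the advance of the right end of the box. -/
theorem runs_reusePrefix {B n i l r zf : ℕ} {s : ℕ → ℤ} {σ : State} (hB : n + 2 ≤ B)
    (h : BoxInv s n i l r σ) (hin : i < n) (hzf : IsPrefLen s n i zf) :
    reusePrefix.wp B (fun τ => ∃ z : ℕ, τ.var 9 = z ∧ SameOrder s 0 i z ∧ i + z ≤ n ∧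
      zf + r ≤ z + max r (i + zf)) σ := by
  have hB2 : 2 ≤ B := by omega
  obtain ⟨h6, h7, h8, hi, hr, hbox, htab⟩ := h
  by_cases hir : i < r
  · obtain ⟨hl, hli, hso⟩ := hbox hir
    obtain ⟨z, hz, e12, _⟩ := htab (i - l) (by omega) (by omega)
    have hzn := hz.1
    have e1 : ((i : ℤ) - l).toNat = i - l := by omega
    have hsh := hso.shift (i - l)
    rw [zero_add, show l + (i - l) = i by omega] at hsh
    by_cases hc : r - i < z
    · have hc' : (r : ℤ) - i < z := by omega
      simp [reusePrefix, hB2, h6, h7, h8, hir, e1, e12, hc', Fits]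
      split_ands <;> try omega
      refine ⟨r - i, by omega, (hz.2.1.mono (by omega)).trans (hsh.mono (by omega)), by omega, ?_⟩
      omega
    · have hc' : ¬ (r : ℤ) - i < z := by omega
      simp [reusePrefix, hB2, h6, h7, h8, hir, e1, e12, hc', Fits]
      split_ands <;> try omega
      · exact hz.2.1.trans (hsh.mono (by omega))
      · rcases (not_lt.1 hc).lt_or_eq with hlt | heq
        · have := IsPrefLen.of_box hso (by omega) hz (d := i - l) (by omega)
          rw [show l + (i - l) = i by omega] at this
          have := this.unique hzf
          omega
        · omega
  · simp [reusePrefix, hB2, h6, h8, hir, Fits]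
    split_ands <;> (try omega)
    exact ⟨0, rfl, fun u hu => by omega, by omega, by omega⟩

/-- Stores the length found in variable `9` and updates the box. -/
def storePrefix : Prog :=
  .store 12 (𝕧 6) (𝕧 9) ;; .store 14 (𝕧 6) (𝕧 9 + (𝕧 6 + 𝕧 9 =ₑ 𝕧 0) * 𝕧 6) ;;
  .cond (𝕧 8 <ₑ 𝕧 6 + 𝕧 9) (7 ::= 𝕧 6 ;; 8 ::= 𝕧 6 + 𝕧 9) .skip ;; 6 ::= 𝕧 6 + 1

theorem runs_storePrefix {B n i l r z : ℕ} {s : ℕ → ℤ} {σ : State} (h0 : σ.var 0 = n)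
    (hB : n + 2 ≤ B) (h : BoxInv s n i l r σ) (hin : i < n) (h9 : σ.var 9 = z)
    (hz : IsPrefLen s n i z) :
    storePrefix.wp B (fun τ => ∃ l', BoxInv s n (i + 1) l' (max r (i + z)) τ) σ := by
  have hB2 : 2 ≤ B := by omega
  obtain ⟨h6, h7, h8, hi, hr, hbox, htab⟩ := h
  have hzn := hz.1
  have hval : (z : ℤ) + (if (i : ℤ) + z = n then 1 else 0) * i =
      ((if i + z = n then n else z : ℕ) : ℤ) := by
    by_cases h : i + z = n
    · rw [if_pos (by omega), if_pos h]
      omega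
    · rw [if_neg (by omega), if_neg h]
      omega
  have hle : (if i + z = n then n else z) ≤ n := by split_ifs <;> omega
  have hle' : Fits B ((if (i : ℤ) + z = n then 1 else 0) * i) := by
    simp only [Fits]
    split_ifs <;> omega
  have htab' : ∀ i', 1 ≤ i' → i' < i + 1 → ∃ z' : ℕ, IsPrefLen s n i' z' ∧
      (if i' = i then (z : ℤ) else σ.arr 12 i') = z' ∧
      (if i' = i then ((if i + z = n then n else z : ℕ) : ℤ) else σ.arr 14 i') =
        (if i' + z' = n then n else z' : ℕ) := by
    intro i' h1 h2
    by_cases hii : i' = i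
    · subst hii
      exact ⟨z, hz, by simp, by simp⟩
    · obtain ⟨z', h3, h4, h5⟩ := htab i' h1 (by omega)
      exact ⟨z', h3, by simp [hii, h4], by simp only [if_neg hii, h5]⟩
  have f1 : Fits B (i : ℤ) := by unfold Fits; omega
  have f2 : Fits B (z : ℤ) := by unfold Fits; omega
  have f3 : Fits B (r : ℤ) := by unfold Fits; omega
  have f4 : Fits B (n : ℤ) := by unfold Fits; omega
  have f5 : Fits B ((i : ℤ) + z) := by unfold Fits; omega
  have f6 : Fits B ((i : ℤ) + 1) := by unfold Fits; omega
  have f7 : Fits B ((if i + z = n then n else z : ℕ) : ℤ) := by unfold Fits; omega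
  simp only [storePrefix, wp_seq, wp_store, wp_cond, wp_assign, wp_skip, ok_var, ok_add, ok_mul,
    ok_eq hB2, ok_lt hB2, ok_one hB2, val_var, val_add, val_mul, val_eq, val_lt, val_one,
    setArr_var, setVar_var, h0, h6, h8, h9, f1, f2, f3, f4, f5, f6, hle', hval, f7,
    Nat.cast_nonneg, Int.toNat_natCast, true_and, and_self]
  constructor
  · intro hlt
    have hlt' : r < i + z := by
      by_contra hc
      exact hlt (if_neg (by omega))
    simp [f6, f1, f2, f5]
    refine ⟨i, by simp, by simp, by simp; omega, by omega, by omega, fun _ => ⟨hi, by omega, ?_⟩,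
      fun i' h1 h2 => ?_⟩
    · exact hz.2.1.mono (by omega)
    · simpa using htab' i' h1 h2
  · intro hlt
    have hlt' : ¬ r < i + z := by
      intro hc
      rw [if_pos (by omega)] at hlt
      exact one_ne_zero hlt
    simp
    rw [max_eq_left (by omega)]
    refine ⟨l, by simp, by simp [h7], by simp [h8], by omega, by omega, fun h => ?_,
      fun i' h1 h2 => ?_⟩
    · have := hbox (by omega)
      exact ⟨this.1, by omega, this.2.2⟩
    · simpa using htab' i' h1 h2

/-- Computes, for all positions from `1` on, the length of the longest order-equivalent prefix. -/
def prefixLengths : Prog :=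
  7 ::= 0 ;; 8 ::= 0 ;; 6 ::= 1 ;;
  .loop (𝕧 6 <ₑ 𝕧 0) (reusePrefix ;; extendPrefix ;; storePrefix)

/-- The right end of the box never moves back, so the iterations of `extendPrefix` add up to at most
`n`: the potential is proportional to `(n - i) + (n - r)`. -/
theorem runs_prefixLengths {B n : ℕ} {s : ℕ → ℤ} {σ : State} (h0 : σ.var 0 = n)
    (hs : ∀ u, σ.arr 0 u = s u) (hsB : ∀ u, Fits B (s u)) (hB : n + 2 ≤ B)
    (hnb : ∀ j < n, ∃ a c : ℕ, σ.arr 9 j = a ∧ σ.arr 11 j = c ∧ IsNeighbours s j a c) :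
    Runs B prefixLengths σ (2 * prefixLengths.steps * (n + 1)) fun τ =>
      ∀ i, 1 ≤ i → i < n → ∃ z : ℕ, IsPrefLen s n i z ∧
        τ.arr 14 i = (if i + z = n then n else z : ℕ) := by
  have hB2 : 2 ≤ B := by omega
  set body := reusePrefix ;; extendPrefix ;; storePrefix with hbody
  set K := (Prog.loop (𝕧 6 <ₑ 𝕧 0) body).steps with hK
  have hloop : ∀ σ' : State, σ'.var 0 = n → (∀ u, σ'.arr 0 u = s u) →
      (∀ j < n, ∃ a c : ℕ, σ'.arr 9 j = a ∧ σ'.arr 11 j = c ∧ IsNeighbours s j a c) →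
      BoxInv s n 1 0 0 σ' →
      Runs B (.loop (𝕧 6 <ₑ 𝕧 0) body) σ' (K * (n - 1) + K * n + (𝕧 6 <ₑ 𝕧 0).cost + 1) fun τ =>
        ∀ i, 1 ≤ i → i < n → ∃ z : ℕ, IsPrefLen s n i z ∧
          τ.arr 14 i = (if i + z = n then n else z : ℕ) := by
    intro σ' h0 hs hnb hbox
    refine (Runs.loop (fun p τ => ∃ i l r, BoxInv s n i l r τ ∧ i ≤ n + 1 ∧
      p = K * (n - i) + K * (n - r))
      ?_ ?_ ⟨1, 0, 0, hbox, by omega, by simp⟩).mono le_rfl ?_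
    · rintro p τ ⟨i, l, r, hI, hi, _⟩ hF
      have e0 : τ.var 0 = n := (hF.var 0 rfl).trans h0
      simp [hB2, hI.pos, e0, Fits]
      omega
    · rintro p τ ⟨i, l, r, hI, _, rfl⟩ hF hne
      have e0 : τ.var 0 = n := (hF.var 0 rfl).trans h0
      have hin : i < n := by
        by_contra hc
        simp only [val_lt, val_var, hI.pos, e0] at hne
        exact hne (if_neg (by omega))
      have es : ∀ u, τ.arr 0 u = s u := fun u => by rw [hF.arr 0 rfl, hs]
      obtain ⟨zf, hzf⟩ := exists_isPrefLen s hin.le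
      have hzn := hzf.1
      have hrn := hI.le_length
      have hr' : max r (i + zf) ≤ n := by omega
      refine ⟨reusePrefix.steps + (extendPrefix.steps * (max r (i + zf) - r + 1) +
        storePrefix.steps), K * (n - (i + 1)) + K * (n - max r (i + zf)), ?_, ?_⟩
      · obtain ⟨u, hu⟩ : ∃ u, n = i + 1 + u := ⟨n - (i + 1), by omega⟩
        obtain ⟨v, hv⟩ : ∃ v, max r (i + zf) = r + v := ⟨max r (i + zf) - r, by omega⟩
        obtain ⟨w, hw⟩ : ∃ w, n = r + v + w := ⟨n - (r + v), by omega⟩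
        rw [hv, show n - (i + 1) = u by omega, show n - i = u + 1 by omega,
          show n - (r + v) = w by omega, show n - r = v + w by omega,
          show r + v - r = v by omega]
        have hKle : extendPrefix.steps ≤ K := by
          simp only [hK, hbody, Prog.steps]
          omega
        have hKeq : K = reusePrefix.steps + (extendPrefix.steps + storePrefix.steps) +
          (𝕧 6 <ₑ 𝕧 0).cost + 1 := rfl
        have := Nat.mul_le_mul_right v hKle
        rw [mul_add, mul_add, mul_add]
        omega
      · refine (Runs.of_wp (runs_reusePrefix hB hI hin hzf)).seq fun τ₁ ⟨z, h9, h1, h2, h3⟩ hF₁ =>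
          Runs.seq (P := fun τ => τ.var 9 = zf) ?_ fun τ₂ h9 hF₂ => ?_
        · refine Runs.mono (runs_extendPrefix ((hF₁.var 0 rfl).trans e0)
            (fun u => by rw [hF₁.arr 0 rfl, es]) hsB (fun j hj => ?_)
            ((hF₁.var 6 rfl).trans hI.pos) hI.one_le hin h9 hB h1 h2 hzf)
            (Nat.mul_le_mul_left _ (by omega)) fun _ h _ => h
          rw [hF₁.arr 9 rfl, hF₁.arr 11 rfl, hF.arr 9 rfl, hF.arr 11 rfl]
          exact hnb j hj
        · have hI' : BoxInv s n i l r τ₂ := by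
            obtain ⟨h6, h7, h8, g1, g2, g3, g4⟩ := hI
            refine ⟨?_, ?_, ?_, g1, g2, g3, ?_⟩
            · rw [hF₂.var 6 rfl, hF₁.var 6 rfl, h6]
            · rw [hF₂.var 7 rfl, hF₁.var 7 rfl, h7]
            · rw [hF₂.var 8 rfl, hF₁.var 8 rfl, h8]
            · rw [hF₂.arr 12 rfl, hF₁.arr 12 rfl, hF₂.arr 14 rfl, hF₁.arr 14 rfl]
              exact g4
          refine (Runs.of_wp (runs_storePrefix (by rw [hF₂.var 0 rfl, hF₁.var 0 rfl, e0]) hB hI' hin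
            h9 hzf)).mono le_rfl fun ρ ⟨l', hl'⟩ _ => ⟨i + 1, l', _, hl', by omega, rfl⟩
    · rintro τ ⟨⟨p, i, l, r, hI, _⟩, hv⟩ hF i' h1 h2
      have e0 : τ.var 0 = n := (hF.var 0 rfl).trans h0
      simp only [val_lt, val_var, hI.pos, e0] at hv
      have hin : n ≤ i := by
        by_contra hc
        rw [if_pos (by omega)] at hv
        exact one_ne_zero hv
      obtain ⟨z, h3, _, h4⟩ := hI.table i' h1 (by omega)
      exact ⟨z, h3, h4⟩
  refine (Runs.assign_seq (by simp) (.assign_seq (by simp) (.assign_seq (by simp [hB2])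
    (hloop _ (by simp [h0]) (by simpa using hs) (by simpa using hnb) ?_)))).mono ?_ fun _ h _ => h
  · exact ⟨by simp, by simp, by simp, le_rfl, by omega, by simp, fun i' h1 h2 => by omega⟩
  · have hS : prefixLengths.steps = 2 + (2 + (2 + K)) := rfl
    have h1 : K * (n - 1) ≤ K * n := Nat.mul_le_mul_left _ (by omega)
    have h2 : (𝕧 6 <ₑ 𝕧 0).cost + 1 ≤ K := by
      simp only [hK, Prog.steps]
      omega
    have h3 : Expr.cost 0 + 1 = 2 := rfl
    have h4 : Expr.cost 1 + 1 = 2 := rfl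
    rw [hS, h3, h4]
    nlinarith

/-! ### The sieve -/

/-- For the prime `q` in variable `6`, marks the multiples of `q` in array `13` and replaces, from
right to left, the entry of array `14` at each `j` by its minimum with the entry at `j * q`. -/
def visitMultiples : Prog :=
  7 ::= (𝕧 0 - 1) / 𝕧 6 ;; .loop (0 <ₑ 𝕧 7) (8 ::= 𝕧 7 * 𝕧 6 ;; .store 13 (𝕧 8) 1 ;;
    .cond (𝕒 14 (𝕧 8) <ₑ 𝕒 14 (𝕧 7)) (.store 14 (𝕧 7) (𝕒 14 (𝕧 8))) .skip ;; 7 ::= 𝕧 7 - 1)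

/-- The state of the sieve when the primes below `q` have been treated. -/
structure SieveInv (f : ℕ → ℕ) (n q : ℕ) (σ : State) : Prop where
  mark : ∀ m, 1 ≤ m → m < n → (σ.arr 13 m = 1 ∧ ∃ p, p.Prime ∧ p < q ∧ p ∣ m) ∨
    (σ.arr 13 m = 0 ∧ ¬ ∃ p, p.Prime ∧ p < q ∧ p ∣ m)
  value : ∀ j, 1 ≤ j → j < n → ∃ g : ℕ, σ.arr 14 j = g ∧ g ≤ n ∧
    ∀ v, v ≤ g ↔ LeOnMultiples f n q v j

/-- The state while the multiples of `q` are visited: the entries from `j + 1` on are up to date. -/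
structure VisitInv (f : ℕ → ℕ) (n q j : ℕ) (σ : State) : Prop where
  index : σ.var 7 = j
  mark : ∀ m, 1 ≤ m → m < n →
    (σ.arr 13 m = 1 ∧ ((∃ p, p.Prime ∧ p < q ∧ p ∣ m) ∨ ∃ w, j < w ∧ m = w * q)) ∨
    (σ.arr 13 m = 0 ∧ ¬ ((∃ p, p.Prime ∧ p < q ∧ p ∣ m) ∨ ∃ w, j < w ∧ m = w * q))
  value : ∀ j', 1 ≤ j' → j' < n → ∃ g : ℕ, σ.arr 14 j' = g ∧ g ≤ n ∧
    ∀ v, v ≤ g ↔ LeOnMultiples f n (if j < j' then q + 1 else q) v j'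

theorem runs_visitMultiples {B n q : ℕ} {f : ℕ → ℕ} {σ : State} (h0 : σ.var 0 = n)
    (h6 : σ.var 6 = q) (hq : q.Prime) (hqn : q < n) (hB : n + 2 ≤ B) (h : SieveInv f n q σ) :
    RunsLin B ((n - 1) / q) visitMultiples σ (SieveInv f n (q + 1)) := by
  have hB2 : 2 ≤ B := by omega
  have hq2 := hq.two_le
  set top := (n - 1) / q with htop
  have htn : top ≤ n - 1 := Nat.div_le_self _ _
  have htop' : ∀ j, j ≤ top ↔ j * q < n := fun j => by
    rw [htop, Nat.le_div_iff_mul_le hq.pos]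
    omega
  have hcast : ((n : ℤ) - 1) / q = top := by
    rw [htop]
    push_cast
    rw [Nat.cast_sub (by omega)]
    rfl
  have hbig : ∀ j v, top < j → (LeOnMultiples f n (q + 1) v j ↔ LeOnMultiples f n q v j) :=
    fun j v hj => by
      rw [leOnMultiples_succ_of_prime hq, and_iff_left]
      intro hlt
      have := (htop' j).2 hlt
      omega
  refine .assign_seq (by simp [hB2, h0, h6, Fits, hcast]; omega) ((RunsLin.loop
    (fun t τ => ∃ j, j + t = top ∧ VisitInv f n q j τ)
    top le_rfl ?_ ?_ ?_).mono ?_)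
  · rintro t ht τ ⟨j, hj, e7, _, _⟩ hF
    simp [hB2, e7, Fits]
    omega
  · rintro t ht τ ⟨j', hj', e7, hmark, hval⟩ hF
    obtain ⟨j, rfl⟩ : ∃ j, j' = j + 1 := ⟨j' - 1, by omega⟩
    have e6 : τ.var 6 = q := by rw [hF.var 6 rfl]; simp [h6]
    have hjq := (htop' (j + 1)).1 (by omega)
    have hjq' : (j + 1) * 2 ≤ (j + 1) * q := Nat.mul_le_mul_left _ hq2
    obtain ⟨g, hg1, hg2, hg3⟩ := hval (j + 1) (by omega) (by omega)
    obtain ⟨g', hg1', hg2', hg3'⟩ := hval ((j + 1) * q) (by omega) (by omega)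
    simp only [lt_irrefl, if_false] at hg3
    rw [if_pos (by omega)] at hg3'
    have hmul : ((j : ℤ) + 1) * q = ((j + 1) * q : ℕ) := by push_cast; rfl
    generalize hm : (j + 1) * q = m at *
    have hmark' : ∀ m', 1 ≤ m' → m' < n →
        ((if m' = m then 1 else τ.arr 13 m') = 1 ∧
          ((∃ p, p.Prime ∧ p < q ∧ p ∣ m') ∨ ∃ w, j < w ∧ m' = w * q)) ∨
        ((if m' = m then 1 else τ.arr 13 m') = 0 ∧
          ¬ ((∃ p, p.Prime ∧ p < q ∧ p ∣ m') ∨ ∃ w, j < w ∧ m' = w * q)) := by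
      intro m' h1 h2
      by_cases hmm : m' = m
      · left
        simp only [if_pos hmm, true_and]
        exact .inr ⟨j + 1, by omega, by omega⟩
      · simp only [if_neg hmm]
        have : (∃ w, j < w ∧ m' = w * q) ↔ ∃ w, j + 1 < w ∧ m' = w * q := by
          refine exists_congr fun w => ⟨fun ⟨h3, h4⟩ => ⟨?_, h4⟩, fun ⟨h3, h4⟩ => ⟨by omega, h4⟩⟩
          refine lt_of_le_of_ne h3 ?_
          rintro rfl
          exact hmm (h4.trans hm)
        rw [this]
        exact hmark m' h1 h2
    have hval' : ∀ j', 1 ≤ j' → j' < n → ∃ g₁ : ℕ,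
        (if j' = j + 1 then ((min g g' : ℕ) : ℤ) else τ.arr 14 j') = g₁ ∧ g₁ ≤ n ∧
        ∀ v, v ≤ g₁ ↔ LeOnMultiples f n (if j < j' then q + 1 else q) v j' := by
      intro j' h1 h2
      by_cases hjj : j' = j + 1
      · subst hjj
        refine ⟨min g g', by simp, by omega, fun v => ?_⟩
        rw [if_pos (by omega), leOnMultiples_succ_of_prime hq, hm, ← hg3, ← hg3', le_min_iff]
        exact ⟨fun h => ⟨h.1, fun _ => h.2⟩, fun h => ⟨h.1, h.2 hjq⟩⟩
      · obtain ⟨g₁, h3, h4, h5⟩ := hval j' h1 h2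
        refine ⟨g₁, by rw [if_neg hjj, h3], h4, fun v => ?_⟩
        simp only [h5, show j + 1 < j' ↔ j < j' by omega]
    by_cases hlt : g' < g
    · rw [min_eq_right hlt.le] at hval'
      simp [hB2, e7, e6, hmul, Fits, hg1, hg1', hlt]
      split_ands <;> try omega
      refine ⟨j, by omega, by simp, fun m' h1 h2 => ?_, fun j' h1 h2 => ?_⟩
      · simpa using hmark' m' h1 h2
      · simpa using hval' j' h1 h2
    · rw [min_eq_left (not_lt.1 hlt)] at hval'
      have hval'' : ∀ j', 1 ≤ j' → j' < n → ∃ g₁ : ℕ, τ.arr 14 j' = g₁ ∧ g₁ ≤ n ∧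
          ∀ v, v ≤ g₁ ↔ LeOnMultiples f n (if j < j' then q + 1 else q) v j' := by
        intro j' h1 h2
        have := hval' j' h1 h2
        by_cases hjj : j' = j + 1
        · rw [if_pos hjj, ← hg1, ← hjj] at this
          exact this
        · rw [if_neg hjj] at this
          exact this
      simp [hB2, e7, e6, hmul, Fits, hg1, hg1', hlt]
      split_ands <;> try omega
      refine ⟨j, by omega, by simp, fun m' h1 h2 => ?_, fun j' h1 h2 => ?_⟩
      · simpa using hmark' m' h1 h2
      · simpa using hval'' j' h1 h2
  · refine ⟨top, rfl, by simp [h0, h6, hcast], fun m h1 h2 => ?_, fun j' h1 h2 => ?_⟩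
    · have : ¬ ∃ w, top < w ∧ m = w * q := by
        rintro ⟨w, hw, rfl⟩
        exact absurd ((htop' w).2 h2) (by omega)
      rw [or_iff_left this]
      exact h.mark m h1 h2
    · obtain ⟨g, h3, h4, h5⟩ := h.value j' h1 h2
      refine ⟨g, h3, h4, fun v => ?_⟩
      split_ifs with hc
      · rw [h5, hbig j' v hc]
      · exact h5 v
  · rintro τ ⟨j, hj, _, hmark, hval⟩ _
    obtain rfl : j = 0 := by omega
    refine ⟨fun m h1 h2 => ?_, fun j' h1 h2 => ?_⟩
    · have : (∃ p, p.Prime ∧ p < q + 1 ∧ p ∣ m) ↔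
          ((∃ p, p.Prime ∧ p < q ∧ p ∣ m) ∨ ∃ w, 0 < w ∧ m = w * q) := by
        constructor
        · rintro ⟨p, h3, h4, h5⟩
          rcases Nat.lt_succ_iff_lt_or_eq.1 h4 with h6 | rfl
          · exact .inl ⟨p, h3, h6, h5⟩
          · obtain ⟨w, rfl⟩ := h5
            exact .inr ⟨w, Nat.pos_of_mul_pos_left h1, mul_comm _ _⟩
        · rintro (⟨p, h3, h4, h5⟩ | ⟨w, _, rfl⟩)
          · exact ⟨p, h3, by omega, h5⟩
          · exact ⟨q, hq, by omega, dvd_mul_left _ _⟩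
      rw [this]
      exact hmark m h1 h2
    · have := hval j' h1 h2
      rwa [if_pos (by omega)] at this

/-- The sieve of Eratosthenes, with `visitMultiples` for every prime. It turns the entries of array
`14` into their minima over all multiples of the index. -/
def sieve : Prog :=
  6 ::= 2 ;; .loop (𝕧 6 <ₑ 𝕧 0) (.cond (𝕒 13 (𝕧 6)) .skip visitMultiples ;; 6 ::= 𝕧 6 + 1)

theorem sieveInv_two {f : ℕ → ℕ} {n : ℕ} {σ : State}
    (h13 : ∀ m, σ.arr 13 m = 0) (h14 : ∀ j, 1 ≤ j → j < n → σ.arr 14 j = f j ∧ f j ≤ n) :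
    SieveInv f n 2 σ := by
  refine ⟨fun m _ _ => .inr ⟨h13 m, ?_⟩, fun j h1 h2 => ⟨f j, (h14 j h1 h2).1, (h14 j h1 h2).2,
    fun v => (leOnMultiples_two h2).symm⟩⟩
  rintro ⟨p, hp, h, _⟩
  exact absurd hp.two_le (by omega)

theorem SieveInv.of_eq {f : ℕ → ℕ} {n q : ℕ} {σ τ : State} (h : SieveInv f n q σ)
    (h13 : τ.arr 13 = σ.arr 13) (h14 : τ.arr 14 = σ.arr 14) : SieveInv f n q τ :=
  ⟨by rw [h13]; exact h.mark, by rw [h14]; exact h.value⟩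

/-- The number of steps is linear apart from `n / p` steps for every prime `p < n`. -/
theorem runs_sieve {B n : ℕ} {f : ℕ → ℕ} {σ : State} (h0 : σ.var 0 = n) (hB : n + 2 ≤ B)
    (h13 : ∀ m, σ.arr 13 m = 0) (h14 : ∀ j, 1 ≤ j → j < n → σ.arr 14 j = f j ∧ f j ≤ n) :
    Runs B sieve σ
      (sieve.steps * (∑ p ∈ (Finset.range n).filter Nat.Prime, n / p + 3 * (n + 1)))
      fun τ => ∀ j, 1 ≤ j → j < n → ∃ g : ℕ, τ.arr 14 j = g ∧ g ≤ n ∧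
        ∀ v, v ≤ g ↔ ∀ u, 1 ≤ u → j * u < n → v ≤ f (j * u) := by
  have hB2 : 2 ≤ B := by omega
  set S := sieve.steps with hS
  have hSeq : S = 2 + (((1 + visitMultiples.steps + 2 + 1) + 4) + 3 + 1) := rfl
  refine Runs.mono (Runs.assign_seq (by simp [hB2]) (Runs.iterate
    (fun t τ => τ.var 6 = (t + 2 : ℕ) ∧ SieveInv f n (t + 2) τ) (n - 2)
    (fun t => S * ((if (t + 2).Prime then n / (t + 2) else 0) + 1) + S) ?_ ?_ ?_)) ?_ ?_
  · rintro t ht τ ⟨e6, _⟩ hF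
    have e0 : τ.var 0 = n := by rw [hF.var 0 rfl]; simp [h0]
    simp only [ok_lt hB2, ok_var, val_lt, val_var, e6, e0, Fits, ite_one_ne_zero_iff]
    omega
  · rintro t ht τ ⟨e6, hI⟩ hF
    have e0 : τ.var 0 = n := by rw [hF.var 0 rfl]; simp [h0]
    have hincr : ∀ ρ : State, ρ.var 6 = (t + 2 : ℕ) → SieveInv f n (t + 2 + 1) ρ →
        Runs B (6 ::= 𝕧 6 + 1) ρ 4 fun τ => τ.var 6 = (t + 1 + 2 : ℕ) ∧
          SieveInv f n (t + 1 + 2) τ := by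
      intro ρ e6 hI
      refine Runs.of_wp ?_
      simp only [wp_assign, ok_add, ok_var, ok_one hB2, val_add, val_var, val_one, setVar_var,
        if_true, e6, Fits, true_and]
      refine ⟨by omega, by omega, ?_⟩
      rw [show t + 1 + 2 = t + 2 + 1 by omega]
      exact hI.of_eq rfl rfl
    have hmark := hI.mark (t + 2) (by omega) (by omega)
    have hok : (𝕒 13 (𝕧 6)).Ok B τ := by
      have h01 : τ.arr 13 (t + 2) = 1 ∨ τ.arr 13 (t + 2) = 0 := hmark.imp And.left And.left
      clear hmark
      simp only [ok_read, ok_var, val_var, e6, Int.toNat_natCast, Fits]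
      omega
    have hval : (𝕒 13 (𝕧 6)).val τ = τ.arr 13 (t + 2) := by
      simp only [val_read, val_var, e6, Int.toNat_natCast]
    by_cases hp : (t + 2).Prime
    · have hz : τ.arr 13 (t + 2) = 0 := by
        refine (hmark.resolve_left ?_).1
        rintro ⟨_, p, h1, h2, h3⟩
        rw [Nat.prime_dvd_prime_iff_eq h1 hp] at h3
        omega
      refine Runs.mono (Runs.seq (P := fun ρ => ρ.var 6 = (t + 2 : ℕ) ∧ SieveInv f n (t + 2 + 1) ρ)
        (Runs.cond hok (fun h => absurd (hval.trans hz) h) fun _ =>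
          Runs.mono (runs_visitMultiples e0 e6 hp (by omega) hB hI) le_rfl fun ρ hρ hF' =>
            ⟨(hF'.var 6 rfl).trans e6, hρ⟩)
        fun ρ hρ _ => hincr ρ hρ.1 hρ.2) ?_ fun _ h _ => h
      have h1 : (n - 1) / (t + 2) ≤ n / (t + 2) := Nat.div_le_div_right (by omega)
      have h2 : (𝕒 13 (𝕧 6)).cost = 2 := rfl
      rw [if_pos hp, h2]
      have h3 : visitMultiples.steps * ((n - 1) / (t + 2) + 1) ≤ S * (n / (t + 2) + 1) :=
        Nat.mul_le_mul (by omega) (by omega)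
      omega
    · have hnz : τ.arr 13 (t + 2) ≠ 0 := by
        rcases hmark with h | h
        · rw [h.1]
          exact one_ne_zero
        · refine absurd ⟨(t + 2).minFac, Nat.minFac_prime (by omega), ?_, Nat.minFac_dvd _⟩ h.2
          exact (Nat.not_prime_iff_minFac_lt (by omega)).1 hp
      refine Runs.mono (Runs.seq (T := 1 + 2 + 1)
        (P := fun ρ => ρ.var 6 = (t + 2 : ℕ) ∧ SieveInv f n (t + 2 + 1) ρ)
        (Runs.cond hok (fun _ => Runs.of_wp (c := .skip) ⟨e6, ?_, ?_⟩)
          fun h => absurd (hval.symm.trans h) hnz)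
        fun ρ hρ _ => hincr ρ hρ.1 hρ.2) ?_ fun _ h _ => h
      · intro m h1 h2
        have : (∃ p, p.Prime ∧ p < t + 2 + 1 ∧ p ∣ m) ↔ ∃ p, p.Prime ∧ p < t + 2 ∧ p ∣ m := by
          refine exists_congr fun p => and_congr_right fun h3 => and_congr_left fun _ => ?_
          have : p ≠ t + 2 := fun he => hp (he ▸ h3)
          omega
        rw [this]
        exact hI.mark m h1 h2
      · intro j h1 h2
        obtain ⟨g, h3, h4, h5⟩ := hI.value j h1 h2
        exact ⟨g, h3, h4, fun v => by rw [h5, leOnMultiples_succ_of_not_prime hp]⟩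
      · rw [if_neg hp]
        omega
  · exact ⟨by simp, (sieveInv_two h13 h14).of_eq rfl rfl⟩
  · have h1 : ∑ t ∈ Finset.range (n - 2), (if (t + 2).Prime then n / (t + 2) else 0) ≤
        ∑ p ∈ (Finset.range n).filter Nat.Prime, n / p := by
      rw [Finset.sum_filter]
      calc _ = ∑ p ∈ (Finset.range (n - 2)).map (addRightEmbedding 2),
            if p.Prime then n / p else 0 := by rw [Finset.sum_map]; rfl
        _ ≤ _ := Finset.sum_le_sum_of_subset fun p hp => by
          simp only [Finset.mem_map, Finset.mem_range, addRightEmbedding_apply] at hp ⊢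
          omega
    have h2 : (𝕧 6 <ₑ 𝕧 0).cost = 3 := rfl
    have h3 : Expr.cost 2 = 1 := rfl
    have h4 : 3 + 1 ≤ S := by omega
    rw [h2, h3]
    set A := ∑ p ∈ (Finset.range n).filter Nat.Prime, n / p
    calc _ ≤ 1 + 1 + (∑ t ∈ Finset.range (n - 2),
          (S * (if (t + 2).Prime then n / (t + 2) else 0) + 3 * S) + S) := by
          rw [add_assoc (Finset.sum _ _)]
          refine Nat.add_le_add_left (Nat.add_le_add (Finset.sum_le_sum fun t _ => ?_) h4) _
          rw [mul_add]
          omega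
      _ = 2 + (S * ∑ t ∈ Finset.range (n - 2), (if (t + 2).Prime then n / (t + 2) else 0) +
          (n - 2) * (3 * S) + S) := by
          rw [Finset.sum_add_distrib, ← Finset.mul_sum]
          simp
      _ ≤ 2 + (S * A + n * (3 * S) + S) := by
          gcongr
          omega
      _ ≤ S * (A + 3 * (n + 1)) := by nlinarith
  · rintro τ ⟨_, hI⟩ _ j h1 h2
    obtain ⟨g, h3, h4, h5⟩ := hI.value j h1 h2
    exact ⟨g, h3, h4, fun v => by rw [h5, leOnMultiples_iff_forall h1 (by omega)]⟩

/-! ### The output -/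

/-- Writes those `p` from `1` to `n - 1` that do not exceed the entry of array `14` at `p` to the
output. -/
def listPeriods : Prog :=
  1 ::= 0 ;; 6 ::= 1 ;; .loop (𝕧 6 <ₑ 𝕧 0) (
    .cond (𝕧 6 ≤ₑ 𝕒 14 (𝕧 6)) (.store 1 (𝕧 1) (𝕧 6) ;; 1 ::= 𝕧 1 + 1) .skip ;; 6 ::= 𝕧 6 + 1)

theorem runs_listPeriods {B n : ℕ} {g : ℕ → ℕ} {σ : State} (h0 : σ.var 0 = n) (hB : n + 2 ≤ B)
    (h14 : ∀ j, 1 ≤ j → j < n → σ.arr 14 j = g j ∧ g j ≤ n) :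
    RunsLin B n listPeriods σ fun τ =>
      HasOutput τ ((List.range' 1 (n - 1)).filter fun p => p ≤ g p) := by
  have hB2 : 2 ≤ B := by omega
  refine .assign_seq (by simp) (.assign_seq (by simp [hB2]) ((RunsLin.loop
    (fun t τ => τ.var 6 = (1 + t : ℕ) ∧
      HasOutput τ ((List.range' 1 t).filter fun p => p ≤ g p)) (n - 1) (by omega)
    ?_ ?_ ?_).mono ?_))
  · rintro t ht τ ⟨e6, _⟩ hF
    have e0 : τ.var 0 = n := by rw [hF.var 0 rfl]; simp [h0]
    simp only [ok_lt hB2, ok_var, val_lt, val_var, e6, e0, Fits, ite_one_ne_zero_iff]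
    omega
  · rintro t ht τ ⟨e6, e1, hout⟩ hF
    have e14 : τ.arr 14 (1 + t) = g (1 + t) := by
      rw [hF.arr 14 rfl]
      exact (h14 (1 + t) (by omega) (by omega)).1
    have hgn := (h14 (1 + t) (by omega) (by omega)).2
    have hlen : ((List.range' 1 t).filter fun p => p ≤ g p).length ≤ t :=
      (List.length_filter_le _ _).trans (by simp)
    have hL : ((List.range' 1 (t + 1)).filter fun p => p ≤ g p) =
        ((List.range' 1 t).filter fun p => p ≤ g p) ++
          if 1 + t ≤ g (1 + t) then [1 + t] else [] := by
      rw [List.range'_1_concat, List.filter_append]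
      congr 1
      simp [List.filter_cons]
    rw [hL]
    generalize (List.range' 1 t).filter (fun p => p ≤ g p) = L at *
    have e6' : τ.var 6 = 1 + t := by rw [e6]; push_cast; rfl
    have e6n : ((1 : ℤ) + t).toNat = 1 + t := by omega
    by_cases hc : 1 + t ≤ g (1 + t)
    · have hc' : (1 : ℤ) + t ≤ g (1 + t) := by exact_mod_cast hc
      simp [hB2, e6', e1, e14, e6n, hc, hc', Fits, HasOutput]
      split_ands <;> try omega
      intro i hi
      rcases hi.lt_or_eq with hi | rfl
      · simp [hi.ne, hout i hi, List.getElem_append_left hi]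
      · simp
    · have hc' : ¬ (1 : ℤ) + t ≤ g (1 + t) := by exact_mod_cast hc
      simp [hB2, e6', e1, e14, e6n, hc, hc', Fits, HasOutput]
      split_ands <;> try omega
  · exact ⟨by simp, by simp, by simp⟩
  · exact fun τ hτ _ => hτ.2

/-! ### The complete program -/

/-- The program that computes all initial op-periods. -/
def findPeriods : Prog :=
  boundLetters ;; initKeys ;; radixSort ;; invertOrder ;; initLinks ;; findNeighbours ;;
  prefixLengths ;; sieve ;; listPeriods

/-- The table entry `if i + z = n then n else z` for position `i` bounds exactly those `p` for which
the block of length `p` at `i`, possibly cut off by the end of the string, is order-equivalent to a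
prefix. -/
theorem IsPrefLen.le_ite_iff {s : ℕ → ℤ} {n i z p : ℕ} (h : IsPrefLen s n i z) (hi : i < n)
    (hp : p ≤ n) :
    p ≤ (if i + z = n then n else z) ↔ SameOrder s 0 i (min p (n - i)) := by
  have hz := h.1
  rw [← h.le_iff (by omega)]
  split_ifs <;> omega

theorem runs_findPeriods (S : List ℤ) (k : ℕ) (hS : ∀ a ∈ S, |a| ≤ ((S.length : ℤ) + 2) ^ k) :
    Runs ((S.length + 2) ^ (2 * k + 5)) findPeriods (inputState S)
      (findPeriods.steps * (∑ p ∈ (Finset.range S.length).filter Nat.Prime, S.length / p +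
        3 * (2 * k + 4) * (S.length + 4)))
      fun τ => ∃ L : List ℕ, HasOutput τ L ∧ L.Pairwise (· < ·) ∧
        ∀ p, p ∈ L ↔ IsInitialOpPeriod S p := by
  set n := S.length with hn
  set s : ℕ → ℤ := fun i => S.getD i 0 with hs
  set B := (n + 2) ^ (2 * k + 5) with hBdef
  have hsk : ∀ i, |s i| ≤ ((n : ℤ) + 2) ^ k := fun i => by
    by_cases hi : i < n
    · simp only [hs, List.getD_eq_getElem _ _ hi]
      exact hS _ (List.getElem_mem hi)
    · simp only [hs, List.getD_eq_default _ _ (not_lt.1 hi), abs_zero]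
      positivity
  obtain ⟨M, hM⟩ : ∃ M : ℕ, ∑ i ∈ Finset.range n, s i * s i = M :=
    ⟨_, (Int.toNat_of_nonneg (sum_sq_nonneg s n)).symm⟩
  have hMle : M ≤ (n + 2) ^ (2 * k + 1) := by
    have h1 : (M : ℤ) ≤ ∑ i ∈ Finset.range n, ((n : ℤ) + 2) ^ (2 * k) := by
      rw [← hM]
      refine Finset.sum_le_sum fun i _ => ?_
      rw [← abs_mul_abs_self, two_mul, pow_add]
      exact mul_le_mul (hsk i) (hsk i) (abs_nonneg _) (by positivity)
    rw [Finset.sum_const, Finset.card_range, nsmul_eq_mul] at h1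
    have h2 : M ≤ n * (n + 2) ^ (2 * k) := by exact_mod_cast h1
    refine h2.trans ?_
    rw [pow_succ, mul_comm]
    exact Nat.mul_le_mul_left _ (by omega)
  have hXle : (2 * M + 1) * (n + 2) ≤ (n + 2) ^ (2 * k + 3 + 1) := by
    have h1 : 1 ≤ (n + 2) ^ (2 * k + 1) := Nat.one_le_pow _ _ (by omega)
    calc _ ≤ (4 * (n + 2) ^ (2 * k + 1)) * (n + 2) := Nat.mul_le_mul_right _ (by omega)
      _ ≤ ((n + 2) ^ 2 * (n + 2) ^ (2 * k + 1)) * (n + 2) :=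
          Nat.mul_le_mul_right _ (Nat.mul_le_mul_right _ (by nlinarith))
      _ = _ := by ring
  have hXB : (2 * M + 1) * (n + 2) * (n + 2) ≤ B := by
    calc _ ≤ (n + 2) ^ (2 * k + 3 + 1) * (n + 2) := Nat.mul_le_mul_right _ hXle
      _ = B := by rw [hBdef]; ring
  have hXB' : (2 * M + 1) * (n + 2) ≤ B := (Nat.le_mul_of_pos_right _ (by omega)).trans hXB
  have hNB : n + 2 + 2 ≤ B := by
    have h1 : 2 * (n + 2) ≤ (n + 2) * (n + 2) := Nat.mul_le_mul_right _ (by omega)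
    have h2 : 1 * ((n + 2) * (n + 2)) ≤ (2 * M + 1) * ((n + 2) * (n + 2)) :=
      Nat.mul_le_mul_right _ (by omega)
    rw [← mul_assoc (2 * M + 1), one_mul] at h2
    omega
  have hnB : n + 2 ≤ B := by omega
  have hMB : M ≤ B := by
    have := Nat.le_mul_of_pos_right (2 * M + 1) (show 0 < n + 2 by omega)
    omega
  have hsB : ∀ u, Fits B (s u) := fun u => by
    have h1 : (n + 2) ^ k ≤ B := Nat.pow_le_pow_right (by omega) (by omega)
    have h2 : ((n : ℤ) + 2) ^ k ≤ B := by exact_mod_cast h1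
    exact abs_le.1 ((hsk u).trans h2)
  have hsM : ∀ i < n, -(M : ℤ) ≤ s i ∧ s i ≤ M := fun i hi => by
    have h1 := sum_sq_mono s (show i + 1 ≤ n from hi)
    rw [Finset.sum_range_succ, hM] at h1
    have h2 := sum_sq_nonneg s i
    have h3 := abs_le_mul_self (s i)
    omega
  -- The keys are distinct modulo `n + 2`, and their order refines the order of the letters.
  obtain ⟨y, hy⟩ : ∃ y : ℕ → ℕ, ∀ i < n, s i + M = y i ∧ y i ≤ 2 * M :=
    ⟨fun i => (s i + M).toNat, fun i hi => by have := hsM i hi; simp only; omega⟩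
  set x : ℕ → ℕ := fun i => y i * (n + 2) + i with hx
  have hxN : ∀ i < n, x i % (n + 2) = i := fun i hi => by
    simp only [hx]
    rw [Nat.mul_add_mod', Nat.mod_eq_of_lt (by omega)]
  have hxX : ∀ i < n, x i < (2 * M + 1) * (n + 2) := fun i hi => by
    have := Nat.mul_le_mul_right (n + 2) (hy i hi).2
    simp only [hx, add_mul]
    omega
  have hxs : ∀ i < n, ∀ i' < n, x i ≤ x i' → s i ≤ s i' := fun i hi i' hi' hle => by
    by_contra hlt
    have h1 := (hy i hi).1
    have h2 := (hy i' hi').1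
    have h3 := Nat.mul_le_mul_right (n + 2) (show y i' + 1 ≤ y i by omega)
    simp only [hx] at hle
    rw [add_mul] at h3
    omega
  have hxinj : ∀ i < n, ∀ i' < n, x i = x i' → i = i' := fun i hi i' hi' h => by
    rw [← hxN i hi, h, hxN i' hi']
  obtain ⟨π, hπ, hπ'⟩ := exists_inverse_rk hxinj
  have h0 : (inputState S).var 0 = n := rfl
  have hs0 : ∀ u, (inputState S).arr 0 u = s u := fun u => rfl
  refine Runs.mono (Runs.seq (runs_boundLetters h0 hs0 hnB (by rw [hM]; exact_mod_cast hMB))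
    fun τ₁ ⟨e2, e3⟩ hF₁ => Runs.seq (runs_initKeys (M := M) ((hF₁.var 0 rfl).trans h0) e2
      (e3.trans hM) (fun u => by rw [hF₁.arr 0 rfl, hs0]) hsM (by omega) (by exact_mod_cast hXB'))
    fun τ₂ ⟨e4, e5, ex⟩ hF₂ => ?_) (T := boundLetters.steps * (n + 1) + (initKeys.steps * (n + 1) +
      (radixSort.steps * (n + 2 + 2) * (2 * k + 3 + 1) + (invertOrder.steps * (n + 1 + 1) +
      (initLinks.steps * (n + 1 + 1) + (findNeighbours.steps * (n + 1 + 1) +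
      (2 * prefixLengths.steps * (n + 1) + (sieve.steps *
      (∑ p ∈ (Finset.range n).filter Nat.Prime, n / p + 3 * (n + 1)) +
      listPeriods.steps * (n + 1))))))))) ?_ fun _ h _ => h
  swap
  · set A := ∑ p ∈ (Finset.range n).filter Nat.Prime, n / p
    have hsteps : findPeriods.steps = boundLetters.steps + (initKeys.steps + (radixSort.steps +
      (invertOrder.steps + (initLinks.steps + (findNeighbours.steps + (prefixLengths.steps +
      (sieve.steps + listPeriods.steps))))))) := rfl
    have h1 : n + 1 + 1 ≤ A + 3 * (2 * k + 4) * (n + 4) := by nlinarith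
    have h2 : (n + 2 + 2) * (2 * k + 3 + 1) ≤ A + 3 * (2 * k + 4) * (n + 4) := by nlinarith
    have h3 : 2 * (n + 1) ≤ A + 3 * (2 * k + 4) * (n + 4) := by nlinarith
    have h4 : A + 3 * (n + 1) ≤ A + 3 * (2 * k + 4) * (n + 4) := by nlinarith
    have h5 : n + 1 ≤ A + 3 * (2 * k + 4) * (n + 4) := by omega
    rw [hsteps, add_mul, add_mul, add_mul, add_mul, add_mul, add_mul, add_mul, add_mul,
      mul_assoc radixSort.steps, mul_comm 2 prefixLengths.steps, mul_assoc prefixLengths.steps]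
    gcongr
  have f0 : τ₂.var 0 = n := by rw [hF₂.var 0 rfl, hF₁.var 0 rfl, h0]
  have fs : ∀ u, τ₂.arr 0 u = s u := fun u => by rw [hF₂.arr 0 rfl, hF₁.arr 0 rfl, hs0]
  have f13 : ∀ u, τ₂.arr 13 u = 0 := fun u => by rw [hF₂.arr 13 rfl, hF₁.arr 13 rfl]; rfl
  refine Runs.seq (runs_radixSort (x := x) (N := n + 2) (X := (2 * M + 1) * (n + 2)) f0
    ((hF₂.var 2 rfl).trans (by rw [e2]; push_cast; rfl)) (by rw [e4]; push_cast; rfl)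
    (by rw [e5]; push_cast; rfl) (by omega) (by omega) hNB hXB hXle (fun i hi => ⟨?_, hxX i hi⟩) hxN
    fun i hi => (ex i hi).2) fun τ₃ h3 hF₃ => ?_
  · rw [(ex i hi).1, (hy i hi).1]
    simp only [hx]
    push_cast
    rfl
  replace f0 := (hF₃.var 0 rfl).trans f0
  replace fs : ∀ u, τ₃.arr 0 u = s u := fun u => by rw [hF₃.arr 0 rfl, fs]
  replace f13 : ∀ u, τ₃.arr 13 u = 0 := fun u => by rw [hF₃.arr 13 rfl, f13]
  refine Runs.seq (runs_invertOrder (π := π) (R := fun i => rk x n i + 1) f0 hnB (fun t ht => ?_)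
    (fun t ht => ⟨(hπ t ht).1, by rw [(hπ t ht).2]⟩)
    fun i hi => ⟨_, rk_lt hi, rfl, hπ' i hi⟩) fun τ₄ h6 hF₄ => ?_
  · have := h3 _ (hπ t ht).1
    rwa [(hπ t ht).2] at this
  replace f0 := (hF₄.var 0 rfl).trans f0
  replace fs : ∀ u, τ₄.arr 0 u = s u := fun u => by rw [hF₄.arr 0 rfl, fs]
  replace f13 : ∀ u, τ₄.arr 13 u = 0 := fun u => by rw [hF₄.arr 13 rfl, f13]
  refine Runs.seq (runs_initLinks f0 hnB) fun τ₅ h7 hF₅ => ?_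
  replace f0 := (hF₅.var 0 rfl).trans f0
  replace fs : ∀ u, τ₅.arr 0 u = s u := fun u => by rw [hF₅.arr 0 rfl, fs]
  replace f13 : ∀ u, τ₅.arr 13 u = 0 := fun u => by rw [hF₅.arr 13 rfl, f13]
  refine Runs.seq (runs_findNeighbours (R := fun i => rk x n i + 1) (s := s) f0 hnB
    (fun i hi => by rw [hF₅.arr 6 rfl, hF₅.arr 10 rfl]; exact h6 i hi) h7
    (fun i hi => ⟨by omega, rk_lt hi⟩) (fun i hi i' hi' h => ?_)
    (fun r h1 h2 => ⟨π (r - 1), (hπ (r - 1) (by omega)).1, ?_⟩) (fun i hi i' hi' h => ?_))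
    fun τ₆ hnb hF₆ => ?_
  · rw [← hπ' i hi, ← hπ' i' hi', Nat.add_right_cancel h]
  · have := (hπ (r - 1) (by omega)).2
    omega
  · refine hxs i hi i' hi' (not_lt.1 fun hlt => ?_)
    have := rk_lt_rk hi' hlt
    omega
  replace f0 := (hF₆.var 0 rfl).trans f0
  replace fs : ∀ u, τ₆.arr 0 u = s u := fun u => by rw [hF₆.arr 0 rfl, fs]
  replace f13 : ∀ u, τ₆.arr 13 u = 0 := fun u => by rw [hF₆.arr 13 rfl, f13]
  refine Runs.seq (runs_prefixLengths f0 fs hsB hnB hnb) fun τ₇ hz hF₇ => ?_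
  replace f0 := (hF₇.var 0 rfl).trans f0
  replace f13 : ∀ u, τ₇.arr 13 u = 0 := fun u => by rw [hF₇.arr 13 rfl, f13]
  choose! zf hzf e14 using hz
  refine Runs.seq (runs_sieve (f := fun i => if i + zf i = n then n else zf i) f0 hnB f13
    fun j h1 h2 => ⟨e14 j h1 h2, ?_⟩) fun τ₈ hg hF₈ => ?_
  · have := (hzf j h1 h2).1
    split_ifs <;> omega
  replace f0 := (hF₈.var 0 rfl).trans f0
  choose! g hg₁ hg₂ hg₃ using hg
  refine Runs.mono (runs_listPeriods (g := g) f0 hnB fun j h1 h2 => ⟨hg₁ j h1 h2, hg₂ j h1 h2⟩)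
    le_rfl fun τ hτ _ => ⟨_, hτ, (List.pairwise_lt_range' 1).filter _, fun p => ?_⟩
  rw [isInitialOpPeriod_iff, List.mem_filter, List.mem_range'_1, decide_eq_true_iff]
  constructor
  · rintro ⟨⟨hp, hpn⟩, hle⟩
    rw [hg₃ p hp (by omega)] at hle
    refine ⟨hp, by omega, fun u hu => ?_⟩
    rcases Nat.eq_zero_or_pos u with rfl | hu0
    · exact fun _ _ _ _ => Iff.rfl
    · exact ((hzf _ (Nat.mul_pos hp hu0) hu).le_ite_iff hu (by omega)).1 (hle u hu0 hu)
  · rintro ⟨hp, hpn, h⟩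
    refine ⟨⟨hp, by omega⟩, ?_⟩
    rw [hg₃ p hp hpn]
    exact fun u hu0 hu =>
      ((hzf _ (Nat.mul_pos hp hu0) hu).le_ite_iff hu (by omega)).2 (h u hu)

theorem natCast_isBigO_mul_log_log :
    (fun n : ℕ => (n : ℝ)) =O[Filter.atTop] fun n : ℕ => (n : ℝ) * Real.log (Real.log (n : ℝ)) := by
  refine Asymptotics.IsBigO.of_bound 1 ?_
  have hlarge : ∀ᶠ n : ℕ in Filter.atTop, (1 : ℝ) ≤ Real.log (Real.log n) :=
    (Real.tendsto_log_atTop.comp (Real.tendsto_log_atTop.comp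
      tendsto_natCast_atTop_atTop)).eventually_ge_atTop 1
  filter_upwards [hlarge] with n hn
  rw [Real.norm_of_nonneg (by positivity), Real.norm_of_nonneg (by positivity), one_mul]
  exact le_mul_of_one_le_right (Nat.cast_nonneg n) hn

theorem runningTime_isBigO (c d : ℕ) :
    (fun n : ℕ => ((c * (∑ p ∈ (Finset.range n).filter Nat.Prime, n / p + d * (n + 4)) : ℕ) : ℝ))
      =O[Filter.atTop] fun n : ℕ => (n : ℝ) * Real.log (Real.log (n : ℝ)) := by
  have h4 : (fun n : ℕ => (n : ℝ) + 4) =O[Filter.atTop] fun n : ℕ => (n : ℝ) := by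
    refine Asymptotics.IsBigO.of_bound 5 ?_
    filter_upwards [Filter.eventually_ge_atTop 1] with n hn
    have : (1 : ℝ) ≤ n := by exact_mod_cast hn
    rw [Real.norm_of_nonneg (by positivity), Real.norm_of_nonneg (by positivity)]
    linarith
  have h := (sum_div_primes_isBigO.add
    ((h4.trans natCast_isBigO_mul_log_log).const_mul_left (d : ℝ))).const_mul_left (c : ℝ)
  exact h.congr_left fun n => by push_cast; ring

end OpPeriods

theorem mainTheorem5 :
    ∃ prog : OpPeriods.Prog, ∀ k : ℕ, ∃ (K : ℕ) (T : ℕ → ℕ),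
      ((fun n : ℕ => (T n : ℝ)) =O[Filter.atTop]
        fun n : ℕ => (n : ℝ) * Real.log (Real.log (n : ℝ))) ∧
      ∀ S : List ℤ, (∀ a ∈ S, |a| ≤ ((S.length : ℤ) + 2) ^ k) →
        ∃ (t : ℕ) (τ : OpPeriods.State) (L : List ℕ),
          OpPeriods.Exec ((S.length + 2) ^ K) prog (OpPeriods.inputState S) t τ ∧
          t ≤ T S.length ∧
          OpPeriods.HasOutput τ L ∧
          L.Pairwise (· < ·) ∧
          ∀ p : ℕ, p ∈ L ↔ OpPeriods.IsInitialOpPeriod S p := by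
  refine ⟨OpPeriods.findPeriods, fun k => ⟨2 * k + 5, _,
    OpPeriods.runningTime_isBigO OpPeriods.findPeriods.steps (3 * (2 * k + 4)), fun S hS => ?_⟩⟩
  obtain ⟨t, τ, h1, h2, L, h3, h4, h5⟩ := OpPeriods.runs_findPeriods S k hS
  exact ⟨t, τ, L, h1, h2, h3, h4, h5⟩
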